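/- Let $S_N$ act on polynomials in $x_1,\dots,x_N$ by $(wf)(x)=f(xw)$, $(xw)_i=x_{w(i)}$, and for a parameter $\kappa$ and $1\le i\le N$ put $$\mathcal D_i(\kappa)f=\frac{\partial f}{\partial x_i}+\kappa\sum_{j\ne i}\frac{f-(i\,j)f}{x_i-x_j},\qquad \mathcal U_i(\kappa)f=\mathcal D_i(\kappa)(x_if)-\kappa\sum_{j<i}(j\,i)f .$$ A nonzero polynomial $f$ is called singular for $\kappa_0$ if $\mathcal D_i(\kappa_0)f=0$ for all $i$. For a partition $\tau=(\tau_1\ge\dots\ge\tau_N\ge0)$ of $N$, a polynomial is of isotype $\tau$ if it lies in an irreducible $S_N$-submodule, consisting of homogeneous polynomials of one degree, that is isomorphic to the Specht module $S^\tau$; let $\ell(\tau)=\max\{j:\tau_j>0\}$. For $\alpha\in\mathbb N_0^N$ let $|\alpha|=\sum_i\alpha_i$, let $\alpha^+$ be the nonincreasing rearrangement of $\alpha$, and put $$r(\alpha,i)=\#\{j:\alpha_j>\alpha_i\}+\#\{j\le i:\alpha_j=\alpha_i\},\qquad \xi_i(\alpha;\kappa)=(N-r(\alpha,i))\kappa+\alpha_i+1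 .$$ Write $\alpha\succ\beta$ if $\alpha\ne\beta$ and $\sum_{i\le j}\alpha_i\ge\sum_{i\le j}\beta_i$ for all $j$, and $\alpha\vartriangleright\beta$ if $|\alpha|=|\beta|$ and either $\alpha^+\succ\beta^+$, or $\alpha^+=\beta^+$ and $\alpha\succ\beta$. **Theorem.** Let $K$ be a field of characteristic $0$, let $m,n\in\mathbb N$ with $\gcd(m,n)=1$ and $2\le n\le N$, put $\kappa_0=-\frac mn$, and let $\tau$ be a partition of $N$. Suppose that there is a singular polynomial for $\kappa_0$ of isotype $\tau$ with coefficients in $K$. Then: 1. $n\mid(\tau_i+1)$ for $1\le i<\ell(\tau)$. 2. There is a partition $\lambda\in\mathbb N_0^N$ with $$\lambda_{N+1-i}=-\kappa_0\sum_{j=1}^{s-1}(\tau_j+1)\quad\text{for}\quad\sum_{j=1}^{s-1}\tau_j<i\le\sum_{j=1}^{s}\tau_j .$$ There is a unique polynomial $g_\lambda\in K[x_1,\dots,x_N]$ of the form $g_\lambda=x^\lambda+\sum_{\beta\vartriangleleft\lambda}A_\beta x^\beta$ that is singular for $\kappa_0$, is of isotype $\tau$, and satisfies $\mathcal U_i(\kappa_0)g_\lambda=\xi_i(\lambda;\kappa_0)g_\lambda$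 for $1\le i\le N$. All its coefficients $A_\beta$ are rational. 3. Let $M$ be any irreducible $S_N$-module of homogeneous polynomials over $K$ that corresponds to $\tau$ and all of whose elements are annihilated by every $\mathcal D_i(\kappa_0)$. For a standard Young tableau $T$ of shape $\tau$ let $f_T$ be the (up to scalars unique) nonzero element of $M$ with $\omega_if_T=\eta_i(T)f_T$ for $1\le i\le N$, where $\omega_i=\sum_{j=N-i+2}^{N}(N+1-i,\,j)$ (so $\omega_1=0$) and $\eta_i(T)$ is the content (column minus row) of the node of $T$ containing $i$. Let $C$ be the set of all $\alpha$ such that, for some $T$, $\alpha$ is $\vartriangleright$-maximal among the exponents of the monomials that occur in $f_T$. Then $\lambda$ is the unique $\vartriangleright$-maximal element of $C$. -/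

import Mathlib

open MvPolynomial Finset

namespace SingularPoly

/-! Indices `1, …, N` are modelled by `Fin N` (the paper-style index `i` is the element with value
`i - 1`).  Compositions are functions `Fin N → ℕ`; exponents of monomials are `Fin N →₀ ℕ`. -/

/-! ### The action of the symmetric group on polynomials -/

section Action

variable {K : Type*} [Field K] {N : ℕ}

/-- The action `(w f)(x) = f(x w)` with `(x w)_i = x_{w(i)}`, i.e. `w` sends `x_i` to `x_{w(i)}`. -/
noncomputable def permRep (K : Type*) [Field K] (N : ℕ) :
    Representation K (Equiv.Perm (Fin N)) (MvPolynomial (Fin N) K) where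
  toFun w := (rename (R := K) (w : Fin N → Fin N)).toLinearMap
  map_one' := by
    refine LinearMap.ext fun f => ?_
    simp
  map_mul' v w := by
    refine LinearMap.ext fun f => ?_
    simp [rename_rename, Equiv.Perm.coe_mul]

@[simp] theorem permRep_apply (w : Equiv.Perm (Fin N)) (f : MvPolynomial (Fin N) K) :
    permRep K N w f = rename (w : Fin N → Fin N) f := rfl

/-- `f - (i j) f` is divisible by `x_i - x_j`. -/
theorem X_sub_X_dvd (i j : Fin N) (f : MvPolynomial (Fin N) K) :
    (X i - X j : MvPolynomial (Fin N) K) ∣ f - permRep K N (Equiv.swap i j) f := by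
  rw [permRep_apply]
  induction f using MvPolynomial.induction_on with
  | C a => simp
  | add p q hp hq =>
    rw [map_add, add_sub_add_comm]
    exact dvd_add hp hq
  | mul_X p k hp =>
    have hk : (X i - X j : MvPolynomial (Fin N) K) ∣ X k - X (Equiv.swap i j k) := by
      rcases eq_or_ne k i with rfl | hki
      · simp
      · rcases eq_or_ne k j with rfl | hkj
        · rw [Equiv.swap_apply_right]
          exact (dvd_neg.mpr dvd_rfl).trans (neg_sub (X i) (X k)).dvd
        · simp [Equiv.swap_apply_of_ne_of_ne hki hkj]
    have h : p * X k - rename (Equiv.swap i j) (p * X k)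
        = (p - rename (Equiv.swap i j) p) * X k
          + rename (Equiv.swap i j) p * (X k - X (Equiv.swap i j k)) := by
      rw [map_mul, rename_X]
      ring
    rw [h]
    exact dvd_add (hp.mul_right _) (hk.mul_left _)

/-- The polynomial `(f - (i j) f) / (x_i - x_j)`. -/
noncomputable def divDiff (i j : Fin N) (f : MvPolynomial (Fin N) K) : MvPolynomial (Fin N) K :=
  (X_sub_X_dvd i j f).choose

theorem divDiff_spec (i j : Fin N) (f : MvPolynomial (Fin N) K) :
    (X i - X j) * divDiff i j f = f - permRep K N (Equiv.swap i j) f :=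
  (X_sub_X_dvd i j f).choose_spec.symm

/-- For `i ≠ j` the quotient is determined by its defining equation. -/
theorem divDiff_unique {i j : Fin N} (hij : i ≠ j) {f q : MvPolynomial (Fin N) K}
    (hq : (X i - X j) * q = f - permRep K N (Equiv.swap i j) f) : q = divDiff i j f := by
  have h0 : (X i - X j : MvPolynomial (Fin N) K) ≠ 0 :=
    sub_ne_zero.mpr fun h => hij (X_injective h)
  exact mul_left_cancel₀ h0 (hq.trans (divDiff_spec i j f).symm)

/-- The Dunkl operator
`D_i(κ) f = ∂f/∂x_i + κ ∑_{j ≠ i} (f - (i j) f) / (x_i - x_j)`. -/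
noncomputable def dunkl (κ : K) (i : Fin N) (f : MvPolynomial (Fin N) K) :
    MvPolynomial (Fin N) K :=
  pderiv i f + κ • ∑ j ∈ univ.filter (fun j => j ≠ i), divDiff i j f

/-- The operator `U_i(κ) f = D_i(κ)(x_i f) - κ ∑_{j < i} (j i) f`. -/
noncomputable def opU (κ : K) (i : Fin N) (f : MvPolynomial (Fin N) K) :
    MvPolynomial (Fin N) K :=
  dunkl κ i (X i * f)
    - κ • ∑ j ∈ univ.filter (fun j => j < i), permRep K N (Equiv.swap j i) f

/-- A singular polynomial for the parameter value `κ`: nonzero and annihilated by every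
`D_i(κ)`. -/
def IsSingular (κ : K) (f : MvPolynomial (Fin N) K) : Prop :=
  f ≠ 0 ∧ ∀ i, dunkl κ i f = 0

end Action

/-! ### Compositions, partitions and orders -/

section Compositions

variable {N : ℕ}

/-- `τ` is a partition of `N` (written with trailing zeros as an element of `ℕ^N`). -/
def IsPartition (τ : Fin N → ℕ) : Prop :=
  Antitone τ ∧ ∑ i, τ i = N

/-- The length `ℓ(α) = max {j : α_j > 0}` (with `j` counted from `1`; it is `0` for `α = 0`). -/
def len (α : Fin N → ℕ) : ℕ :=
  (univ.filter (fun j => 0 < α j)).sup (fun j => (j : ℕ) + 1)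

/-- `α⁺`, the nonincreasing rearrangement of `α`. -/
def sorted (α : Fin N → ℕ) : Fin N → ℕ :=
  fun i => α (Tuple.sort α i.rev)

/-- `α⁺` is a partition and a rearrangement of `α`. -/
theorem sorted_spec (α : Fin N → ℕ) :
    Antitone (sorted α) ∧ ∃ w : Equiv.Perm (Fin N), sorted α = α ∘ w := by
  refine ⟨fun i j h => Tuple.monotone_sort α (Fin.rev_le_rev.mpr h), ?_⟩
  exact ⟨Fin.revPerm.trans (Tuple.sort α), rfl⟩

/-- `α ≻ β`. -/
def Dominates (α β : Fin N → ℕ) : Prop :=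
  α ≠ β ∧ ∀ j : Fin N,
    ∑ i ∈ univ.filter (fun i => i ≤ j), β i ≤ ∑ i ∈ univ.filter (fun i => i ≤ j), α i

/-- `α ▷ β`: `|α| = |β|` and either `α⁺ ≻ β⁺`, or `α⁺ = β⁺` and `α ≻ β`. -/
def Above (α β : Fin N → ℕ) : Prop :=
  ∑ i, α i = ∑ i, β i ∧
    (Dominates (sorted α) (sorted β) ∨ (sorted α = sorted β ∧ Dominates α β))

/-- `α` is `▷`-maximal in the set `S`. -/
def IsMaximalIn (S : Set (Fin N →₀ ℕ)) (α : Fin N →₀ ℕ) : Prop :=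
  α ∈ S ∧ ∀ β ∈ S, ¬ Above β α

/-- The rank function `r(α, i) = #{j : α_j > α_i} + #{j ≤ i : α_j = α_i}`. -/
def rank (α : Fin N → ℕ) (i : Fin N) : ℕ :=
  (univ.filter (fun j => α i < α j)).card + (univ.filter (fun j => j ≤ i ∧ α j = α i)).card

/-- `ξ_i(α; κ) = (N - r(α, i)) κ + α_i + 1`. -/
def xi {K : Type*} [Field K] (κ : K) (α : Fin N → ℕ) (i : Fin N) : K :=
  ((N : K) - (rank α i : K)) * κ + (α i : K) + 1

/-- The equations
`λ_{N+1-i} = -κ₀ ∑_{j<s} (τ_j + 1)` for `∑_{j<s} τ_j < i ≤ ∑_{j≤s} τ_j`,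
written with indices starting at `0`. -/
def IsLambda (κ₀ : ℚ) (τ lam : Fin N → ℕ) : Prop :=
  ∀ s i : Fin N,
    ∑ j ∈ univ.filter (fun j => j < s), τ j ≤ (i : ℕ) →
    (i : ℕ) < ∑ j ∈ univ.filter (fun j => j ≤ s), τ j →
    (lam i.rev : ℚ) = -κ₀ * ∑ j ∈ univ.filter (fun j => j < s), ((τ j : ℚ) + 1)

end Compositions

/-! ### Tableaux, Specht modules and isotypes -/

section Tableaux

variable {N : ℕ}

/-- A tableau of shape `τ`: a bijection from the entries `1, …, N` to the nodes
`{(r, c) : 1 ≤ c ≤ τ_r}` of the Ferrers diagram. -/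
abbrev Tableau (τ : Fin N → ℕ) := Fin N ≃ (Σ r : Fin N, Fin (τ r))

/-- The row of the node containing `k`. -/
def row {τ : Fin N → ℕ} (T : Tableau τ) (k : Fin N) : ℕ := ((T k).1 : ℕ)

/-- The column of the node containing `k`. -/
def col {τ : Fin N → ℕ} (T : Tableau τ) (k : Fin N) : ℕ := ((T k).2 : ℕ)

/-- Standard Young tableaux: entries increase along rows and along columns. -/
def IsStandard {τ : Fin N → ℕ} (T : Tableau τ) : Prop :=
  (∀ a b, row T a = row T b → col T a < col T b → a < b) ∧
  (∀ a b, col T a = col T b → row T a < row T b → a < b)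

/-- The content (column minus row) of the node containing `k`. -/
def content {τ : Fin N → ℕ} (T : Tableau τ) (k : Fin N) : ℤ := (col T k : ℤ) - (row T k : ℤ)

/-- The Specht polynomial of a tableau: the product over all columns of the Vandermonde products
`x_a - x_b`, with `a` above `b` in the same column. -/
noncomputable def spechtPoly (K : Type*) [Field K] {τ : Fin N → ℕ} (T : Tableau τ) :
    MvPolynomial (Fin N) K :=
  ∏ p ∈ univ.filter (fun p : Fin N × Fin N => col T p.1 = col T p.2 ∧ row T p.1 < row T p.2),
    (X p.1 - X p.2)

theorem rename_spechtPoly (K : Type*) [Field K] {τ : Fin N → ℕ} (T : Tableau τ)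
    (w : Equiv.Perm (Fin N)) :
    permRep K N w (spechtPoly K T) = spechtPoly K (w.symm.trans T : Tableau τ) := by
  rw [permRep_apply, spechtPoly, spechtPoly, map_prod]
  refine Finset.prod_equiv (w.prodCongr w) ?_ ?_
  · intro p
    have hT (k : Fin N) : (w.symm.trans T) (w k) = T k := by simp
    have hr (k : Fin N) : row (w.symm.trans T : Tableau τ) (w k) = row T k := by
      simp only [row, hT]
    have hc (k : Fin N) : col (w.symm.trans T : Tableau τ) (w k) = col T k := by
      unfold col
      rw [hT]
    rw [Finset.mem_filter, Finset.mem_filter]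
    simp only [Finset.mem_univ, true_and, Equiv.prodCongr_apply, Prod.map_fst, Prod.map_snd,
      hr, hc]
  · intro p _
    simp

/-- The Specht module `S^τ` in Specht's realization: the span of all Specht polynomials of shape
`τ`.  In characteristic zero this is the irreducible representation of the symmetric group labelled
by the partition `τ` (the trivial one for `τ = (N)`, the sign for `τ = (1^N)`). -/
noncomputable def spechtModule (K : Type*) [Field K] (τ : Fin N → ℕ) :
    Subrepresentation (permRep K N) where
  toSubmodule := Submodule.span K (Set.range fun T : Tableau τ => spechtPoly K T)
  apply_mem_toSubmodule w := by
    intro v hv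
    induction hv using Submodule.span_induction with
    | mem x hx =>
      obtain ⟨T, rfl⟩ := hx
      rw [rename_spechtPoly]
      exact Submodule.subset_span ⟨_, rfl⟩
    | zero => simp
    | add x y _ _ hx hy =>
      rw [map_add]
      exact Submodule.add_mem _ hx hy
    | smul a x _ hx =>
      rw [map_smul]
      exact Submodule.smul_mem _ a hx

variable {K : Type*} [Field K]

/-- `M` is an irreducible `S_N`-module, consisting of homogeneous polynomials of some degree `k`,
that corresponds to the partition `τ`. -/
def IsIrreducibleOfType (τ : Fin N → ℕ) (M : Subrepresentation (permRep K N)) : Prop :=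
  M.toRepresentation.IsIrreducible ∧
  (∃ k : ℕ, M.toSubmodule ≤ homogeneousSubmodule (Fin N) K k) ∧
  Nonempty (M.toRepresentation.Equiv (spechtModule K τ).toRepresentation)

/-- `f` is of isotype `τ`: it lies in an irreducible `S_N`-module of homogeneous polynomials
corresponding to `τ`. -/
def HasIsotype (τ : Fin N → ℕ) (f : MvPolynomial (Fin N) K) : Prop :=
  ∃ M : Subrepresentation (permRep K N), IsIrreducibleOfType τ M ∧ f ∈ M

/-- The Murphy element `ω_i = ∑_{j = N-i+2}^{N} (N+1-i, j)` acting on polynomials; the entry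
`N + 1 - i` is `i.rev`. -/
noncomputable def murphy (i : Fin N) (f : MvPolynomial (Fin N) K) : MvPolynomial (Fin N) K :=
  ∑ j ∈ univ.filter (fun j => i.rev < j), permRep K N (Equiv.swap i.rev j) f

/-- `f` is (a scalar multiple of) the element `f_T` of the Murphy basis of `M`: a nonzero element
of `M` with `ω_i f = η_i(T) f` for all `i`, where `η_i(T)` is the content of `i` in `T`. -/
def IsMurphyVector {τ : Fin N → ℕ} (M : Subrepresentation (permRep K N)) (T : Tableau τ)
    (f : MvPolynomial (Fin N) K) : Prop :=
  f ∈ M ∧ f ≠ 0 ∧ ∀ i, murphy i f = (content T i : K) • f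

/-- The set `C` of all exponents that are `▷`-maximal among the exponents of the monomials occurring
in `f_T`, for some standard Young tableau `T` of shape `τ`. -/
def maximalExponents (τ : Fin N → ℕ) (M : Subrepresentation (permRep K N)) :
    Set (Fin N →₀ ℕ) :=
  {α | ∃ T : Tableau τ, IsStandard T ∧ ∃ f, IsMurphyVector M T f ∧ IsMaximalIn (↑f.support) α}

/-- `g` is a singular polynomial for `κ` of isotype `τ`, of the form
`x^λ + ∑_{β ◁ λ} A_β x^β`, with `U_i(κ) g = ξ_i(λ; κ) g` for all `i`. -/
def IsLeadingSingular (κ : K) (τ : Fin N → ℕ) (lam : Fin N →₀ ℕ) (g : MvPolynomial (Fin N) K) :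
    Prop :=
  IsSingular κ g ∧ HasIsotype τ g ∧
  (g.coeff lam = 1 ∧ ∀ β ∈ g.support, β ≠ lam → Above lam β) ∧
  ∀ i, opU κ i g = xi κ lam i • g

end Tableaux

end SingularPoly

open SingularPoly

/-! On singular polynomials the term `x_i D_i` disappears, so `U_i` acts as `1 + κ₀` times the
Murphy element `∑_{j>i} (i j)` (`opU_of_dunkl_eq_zero`). On all polynomials `U_i` is triangular for
`▷`, with diagonal entries `ξ_i` (`coeff_opU_of_isMaximalIn`). Comparing the two at a maximal
exponent `γ` of a singular copy of `S^τ` equates `ξ(γ; κ₀)` with `1 + κ₀` times the contents of a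
standard tableau. Invariance under permutations makes `γ` nonincreasing, and the equations then
force the tableau to be the row reading one (`antitone_of_eigenvalues`), which determines `γ = λ`.
Thus `λ` is the only maximal exponent and lies above all others (`exists_leadingPair`). Integrality
of `λ` and `gcd(m, n) = 1` give the divisibility.

The Murphy spectrum of `S^τ` is found by reading exponents as words, i.e. polynomials as tensors.
Specht polynomials become highest weight vectors of weight `τ` (`isHighestWeight_spechtPoly`). On
such vectors the Murphy elements are lexicographically triangular (`coeff_murphy_of_le`), and
leading words are lattice words (`isLattice_of_isHighestWeight`), which their contents separate
(`eq_of_expContent_eq`). Hence joint eigenvectors span (`mem_span_contentVectors`) and joint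
eigenspaces are at most lines (`IsContentVector.eq_smul`).

Uniqueness of `g_λ`, even across different copies of `S^τ`, comes from rigidity: a singular
equivariant map whose value on the row reading eigenvector has no `x^λ` term is zero
(`IsLeadingPair.map_eq_zero`). Rationality follows, since a `ℚ`-linear projection `K → ℚ` applied to
all coefficients gives another such map with the same leading coefficient. -/

namespace SingularPoly

/-! ### Permutations, divided differences, Dunkl operators and `U_i` -/

section Operators

variable {K : Type*} [Field K] {N : ℕ}

/-- The exponent `β ∘ w`. -/
noncomputable def permExp (w : Equiv.Perm (Fin N)) (β : Fin N →₀ ℕ) : Fin N →₀ ℕ :=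
  Finsupp.equivMapDomain w.symm β

@[simp] theorem permExp_apply (w : Equiv.Perm (Fin N)) (β : Fin N →₀ ℕ) (p : Fin N) :
    permExp w β p = β (w p) := by
  simp [permExp]

theorem coeff_permRep (w : Equiv.Perm (Fin N)) (f : MvPolynomial (Fin N) K) (β : Fin N →₀ ℕ) :
    (permRep K N w f).coeff β = f.coeff (permExp w β) := by
  have h : β = (permExp w β).mapDomain w := by
    ext p
    obtain ⟨q, rfl⟩ := w.surjective p
    rw [Finsupp.mapDomain_apply w.injective, permExp_apply]
  rw [permRep_apply]
  conv_lhs => rw [h]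
  exact coeff_rename_mapDomain _ w.injective _ _

theorem permRep_mul_poly (w : Equiv.Perm (Fin N)) (f g : MvPolynomial (Fin N) K) :
    permRep K N w (f * g) = permRep K N w f * permRep K N w g := by
  simp

theorem permRep_X (w : Equiv.Perm (Fin N)) (i : Fin N) :
    permRep K N w (X i) = X (w i) := by
  simp

theorem permRep_mul_apply (v w : Equiv.Perm (Fin N)) (f : MvPolynomial (Fin N) K) :
    permRep K N (v * w) f = permRep K N v (permRep K N w f) := by
  rw [map_mul]; rfl

theorem permRep_monomial (w : Equiv.Perm (Fin N)) (α : Fin N →₀ ℕ) (a : K) :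
    permRep K N w (monomial α a) = monomial (permExp w⁻¹ α) a := by
  ext β
  rw [coeff_permRep, coeff_monomial, coeff_monomial]
  have : α = permExp w β ↔ permExp w⁻¹ α = β := by
    constructor
    · rintro rfl; ext p; simp
    · rintro rfl; ext p; simp
  simp [this]

theorem permRep_swap_permRep (w : Equiv.Perm (Fin N)) (i j : Fin N)
    (f : MvPolynomial (Fin N) K) :
    permRep K N (Equiv.swap (w i) (w j)) (permRep K N w f) =
      permRep K N w (permRep K N (Equiv.swap i j) f) := by
  rw [← permRep_mul_apply, ← permRep_mul_apply, Equiv.mul_swap_eq_swap_mul]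

theorem divDiff_add {i j : Fin N} (hij : i ≠ j) (f g : MvPolynomial (Fin N) K) :
    divDiff i j (f + g) = divDiff i j f + divDiff i j g := by
  refine (divDiff_unique hij ?_).symm
  rw [mul_add, divDiff_spec, divDiff_spec, map_add]; ring

theorem divDiff_smul {i j : Fin N} (hij : i ≠ j) (c : K) (f : MvPolynomial (Fin N) K) :
    divDiff i j (c • f) = c • divDiff i j f := by
  refine (divDiff_unique hij ?_).symm
  rw [mul_smul_comm, divDiff_spec, map_smul, smul_sub]

theorem divDiff_permRep {i j : Fin N} (hij : i ≠ j) (w : Equiv.Perm (Fin N))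
    (f : MvPolynomial (Fin N) K) :
    divDiff (w i) (w j) (permRep K N w f) = permRep K N w (divDiff i j f) := by
  refine (divDiff_unique (w.injective.ne hij) ?_).symm
  rw [permRep_swap_permRep, ← map_sub, ← divDiff_spec, permRep_mul_poly, map_sub, permRep_X,
    permRep_X]

theorem divDiff_X_mul {i j : Fin N} (hij : i ≠ j) (f : MvPolynomial (Fin N) K) :
    divDiff i j (X i * f) = X i * divDiff i j f + permRep K N (Equiv.swap i j) f := by
  refine (divDiff_unique hij ?_).symm
  rw [mul_add, mul_left_comm, divDiff_spec, permRep_mul_poly, permRep_X, Equiv.swap_apply_left]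
  ring

theorem dunkl_add (κ : K) (i : Fin N) (f g : MvPolynomial (Fin N) K) :
    dunkl κ i (f + g) = dunkl κ i f + dunkl κ i g := by
  have : ∑ j ∈ univ.filter (fun j => j ≠ i), divDiff i j (f + g) =
      ∑ j ∈ univ.filter (fun j => j ≠ i), divDiff i j f +
      ∑ j ∈ univ.filter (fun j => j ≠ i), divDiff i j g := by
    rw [← sum_add_distrib]
    exact sum_congr rfl fun j hj => divDiff_add (mem_filter.1 hj).2.symm f g
  rw [dunkl, dunkl, dunkl, this, map_add, smul_add]; abel

theorem dunkl_smul (κ : K) (i : Fin N) (c : K) (f : MvPolynomial (Fin N) K) :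
    dunkl κ i (c • f) = c • dunkl κ i f := by
  have : ∑ j ∈ univ.filter (fun j => j ≠ i), divDiff i j (c • f) =
      c • ∑ j ∈ univ.filter (fun j => j ≠ i), divDiff i j f := by
    rw [smul_sum]
    exact sum_congr rfl fun j hj => divDiff_smul (mem_filter.1 hj).2.symm c f
  rw [dunkl, dunkl, this, Derivation.map_smul, smul_add, smul_comm]

theorem dunkl_permRep (κ : K) (w : Equiv.Perm (Fin N)) (i : Fin N) (f : MvPolynomial (Fin N) K) :
    dunkl κ (w i) (permRep K N w f) = permRep K N w (dunkl κ i f) := by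
  rw [dunkl, dunkl, map_add, map_smul, map_sum]
  congr 1
  · simp only [permRep_apply]
    exact (pderiv_rename w.injective i f)
  · congr 1
    symm
    refine sum_equiv w (fun j => by simp) fun j hj => ?_
    exact (divDiff_permRep (mem_filter.1 hj).2.symm w f).symm

/-- The polynomials annihilated by all Dunkl operators. -/
noncomputable def singularSubrep (κ : K) : Subrepresentation (permRep K N) where
  toSubmodule :=
    { carrier := {f | ∀ i, dunkl κ i f = 0}
      add_mem' := fun hf hg i => by rw [dunkl_add, hf i, hg i, add_zero]
      zero_mem' := fun i => by simpa using dunkl_smul κ i 0 0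
      smul_mem' := fun c f hf i => by rw [dunkl_smul, hf i, smul_zero] }
  apply_mem_toSubmodule w f hf i := by
    obtain ⟨j, rfl⟩ := w.surjective i
    rw [dunkl_permRep, hf j, map_zero]

/-- The commutation of `D_i` with multiplication by `x_i`, in terms of `U_i`. -/
theorem opU_eq (κ : K) (i : Fin N) (f : MvPolynomial (Fin N) K) :
    opU κ i f = X i * dunkl κ i f + f +
      κ • ∑ j ∈ univ.filter (fun j => i < j), permRep K N (Equiv.swap i j) f := by
  have h1 : ∑ j ∈ univ.filter (fun j => j ≠ i), divDiff i j (X i * f) =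
      X i * ∑ j ∈ univ.filter (fun j => j ≠ i), divDiff i j f +
        ∑ j ∈ univ.filter (fun j => j ≠ i), permRep K N (Equiv.swap i j) f := by
    rw [mul_sum, ← sum_add_distrib]
    exact sum_congr rfl fun j hj => divDiff_X_mul (mem_filter.1 hj).2.symm f
  have h2 : ∑ j ∈ univ.filter (fun j => j ≠ i), permRep K N (Equiv.swap i j) f =
      ∑ j ∈ univ.filter (fun j => j < i), permRep K N (Equiv.swap j i) f +
      ∑ j ∈ univ.filter (fun j => i < j), permRep K N (Equiv.swap i j) f := by
    rw [← sum_filter_add_sum_filter_not _ (fun j => j < i)]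
    congr 1
    · rw [filter_filter]
      refine sum_congr (by ext j; simp; exact fun h => h.ne) fun j _ => ?_
      rw [Equiv.swap_comm]
    · rw [filter_filter]
      refine sum_congr (by ext j; simp; omega) fun j _ => rfl
  rw [opU, dunkl, h1, h2, Derivation.leibniz, pderiv_X_self, dunkl]
  simp only [smul_eq_mul, smul_add, mul_add, mul_smul_comm, mul_one]
  abel

theorem murphy_rev (i : Fin N) (f : MvPolynomial (Fin N) K) :
    murphy i.rev f = ∑ j ∈ univ.filter (fun j => i < j), permRep K N (Equiv.swap i j) f := by
  rw [murphy, Fin.rev_rev]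

theorem opU_of_dunkl_eq_zero {κ : K} {i : Fin N} {f : MvPolynomial (Fin N) K}
    (h : dunkl κ i f = 0) : opU κ i f = f + κ • murphy i.rev f := by
  rw [opU_eq, h, mul_zero, zero_add, murphy_rev]

/-- A geometric sum, after removal of the common factor. Because of the extra `X i`, the exponent of
`x_i` runs from `α j + 1` to `α i`: `x^α` itself is reached at the last `s`, while the swapped
monomial is not. -/
theorem X_mul_divDiff_monomial_of_le {i j : Fin N} (hij : i ≠ j) {α : Fin N →₀ ℕ}
    (h : α j ≤ α i) :
    X i * divDiff i j (monomial α (1 : K)) =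
      ∑ s ∈ range (α i - α j), monomial ((α.update i (α j + 1 + s)).update j (α i - 1 - s)) 1 := by
  have key : divDiff i j (monomial α (1 : K)) = monomial ((α.update i (α j)).update j (α j)) 1 *
      ∑ s ∈ range (α i - α j), X i ^ s * X j ^ (α i - α j - 1 - s) := by
    refine (divDiff_unique hij ?_).symm
    rw [mul_left_comm, mul_comm (X i - X j), geom_sum₂_mul, mul_sub, permRep_monomial,
      X_pow_eq_monomial, X_pow_eq_monomial, monomial_mul, monomial_mul, one_mul]
    congr 2
    · congr 1
      ext p
      rcases eq_or_ne p j with rfl | hj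
      · simp [hij]
      · rcases eq_or_ne p i with rfl | hi
        · simp [hj]; omega
        · simp [hj, hi]
    · congr 1
      ext p
      rcases eq_or_ne p j with rfl | hj
      · simp; omega
      · rcases eq_or_ne p i with rfl | hi
        · simp [hj]
        · simp [hj, hi, Equiv.swap_apply_of_ne_of_ne]
  rw [key, mul_sum, mul_sum]
  refine sum_congr rfl fun s hs => ?_
  rw [mem_range] at hs
  rw [X_pow_eq_monomial, X_pow_eq_monomial, monomial_mul, monomial_mul, X, monomial_mul,
    one_mul, one_mul, one_mul]
  congr 2
  ext p
  rcases eq_or_ne p j with rfl | hj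
  · simp [hij]; omega
  · rcases eq_or_ne p i with rfl | hi
    · simp [hj]; omega
    · simp [hj, hi]

theorem divDiff_swap {i j : Fin N} (hij : i ≠ j) (f : MvPolynomial (Fin N) K) :
    divDiff i j (permRep K N (Equiv.swap i j) f) = - divDiff i j f := by
  refine (divDiff_unique hij ?_).symm
  rw [mul_neg, divDiff_spec, ← permRep_mul_apply, Equiv.swap_mul_self]
  simp

/-- The previous case applied to the swapped monomial, on which the divided difference changes sign.
Here the last `s` gives the swapped monomial, and `x^α` does not occur unless the two exponents
agree. -/
theorem X_mul_divDiff_monomial_of_ge {i j : Fin N} (hij : i ≠ j) {α : Fin N →₀ ℕ}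
    (h : α i ≤ α j) :
    X i * divDiff i j (monomial α (1 : K)) =
      - ∑ s ∈ range (α j - α i), monomial ((α.update i (α i + 1 + s)).update j (α j - 1 - s)) 1 := by
  have h1 : monomial α (1 : K) =
      permRep K N (Equiv.swap i j) (monomial (permExp (Equiv.swap i j) α) 1) := by
    rw [permRep_monomial]
    congr 2
    ext p; simp
  rw [h1, divDiff_swap hij, mul_neg, X_mul_divDiff_monomial_of_le hij (by simpa using h)]
  congr 1
  refine sum_congr (by simp) fun s _ => ?_
  congr 2
  ext p
  rcases eq_or_ne p j with rfl | hj
  · simp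
  · rcases eq_or_ne p i with rfl | hi
    · simp [hj]
    · simp [hj, hi, Equiv.swap_apply_of_ne_of_ne]

end Operators

/-! ### The order `▷` on compositions -/

section Orders

variable {N : ℕ}

theorem sum_le_initial_of_antitone {μ : Fin N → ℕ} (hμ : Antitone μ) (k : Fin N)
    {S : Finset (Fin N)} (hS : S.card = (univ.filter (fun i => i ≤ k)).card) :
    ∑ i ∈ S, μ i ≤ ∑ i ∈ univ.filter (fun i => i ≤ k), μ i := by
  set I := univ.filter (fun i : Fin N => i ≤ k) with hI
  have hc : (S \ I).card = (I \ S).card := by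
    have h1 := card_sdiff_add_card_inter S I
    have h2 := card_sdiff_add_card_inter I S
    rw [inter_comm] at h2
    omega
  have h1 : ∑ i ∈ S \ I, μ i ≤ (S \ I).card • μ k :=
    sum_le_card_nsmul _ _ _ fun i hi => hμ (by simp [hI] at hi; exact hi.2.le)
  have h2 : (I \ S).card • μ k ≤ ∑ i ∈ I \ S, μ i :=
    card_nsmul_le_sum _ _ _ fun i hi => hμ (by simp [hI] at hi; exact hi.1)
  rw [← sum_inter_add_sum_sdiff S I, ← sum_inter_add_sum_sdiff I S, inter_comm I S]
  rw [hc] at h1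
  omega

/-- With the next lemma: partial sums of `α⁺` are the maximal sums of `α` over sets of given size.
Dominance is checked through this, without handling the sorting permutation. -/
theorem sum_le_sorted (α : Fin N → ℕ) (k : Fin N) {S : Finset (Fin N)}
    (hS : S.card = (univ.filter (fun i => i ≤ k)).card) :
    ∑ i ∈ S, α i ≤ ∑ i ∈ univ.filter (fun i => i ≤ k), sorted α i := by
  obtain ⟨ha, w, hw⟩ := sorted_spec α
  refine le_trans (le_of_eq ?_) (sum_le_initial_of_antitone ha k (S := S.map w.symm.toEmbedding)
    (by rw [card_map, hS]))
  rw [sum_map]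
  simp [hw]

theorem exists_sum_eq_sorted (α : Fin N → ℕ) (k : Fin N) :
    ∃ S : Finset (Fin N), S.card = (univ.filter (fun i => i ≤ k)).card ∧
      ∑ i ∈ S, α i = ∑ i ∈ univ.filter (fun i => i ≤ k), sorted α i := by
  obtain ⟨ha, w, hw⟩ := sorted_spec α
  refine ⟨(univ.filter (fun i => i ≤ k)).map w.toEmbedding, by rw [card_map], ?_⟩
  rw [sum_map]
  simp [hw]

theorem eq_of_partial_sums_eq {α β : Fin N → ℕ}
    (h : ∀ j : Fin N, ∑ i ∈ univ.filter (fun i => i ≤ j), α i =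
      ∑ i ∈ univ.filter (fun i => i ≤ j), β i) : α = β := by
  funext j
  induction j using WellFoundedLT.induction with
  | ind j ih =>
    have hj : univ.filter (fun i : Fin N => i ≤ j) = insert j (univ.filter (fun i => i < j)) := by
      ext i; simp [le_iff_lt_or_eq, or_comm]
    have h1 := h j
    rw [hj, sum_insert (by simp), sum_insert (by simp),
      sum_congr rfl fun i hi => ih i (mem_filter.1 hi).2] at h1
    exact Nat.add_right_cancel h1

theorem Dominates.trans {α β γ : Fin N → ℕ} (h1 : Dominates α β) (h2 : Dominates β γ) :
    Dominates α γ := by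
  refine ⟨?_, fun j => (h2.2 j).trans (h1.2 j)⟩
  rintro rfl
  exact h1.1 (eq_of_partial_sums_eq fun j => le_antisymm (h2.2 j) (h1.2 j))

theorem Above.trans {α β γ : Fin N → ℕ} (h1 : Above α β) (h2 : Above β γ) : Above α γ := by
  refine ⟨h1.1.trans h2.1, ?_⟩
  rcases h1.2 with a | ⟨a, a'⟩ <;> rcases h2.2 with b | ⟨b, b'⟩
  · exact Or.inl (a.trans b)
  · exact Or.inl (b ▸ a)
  · exact Or.inl (a ▸ b)
  · exact Or.inr ⟨a.trans b, a'.trans b'⟩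

theorem not_above_self (α : Fin N → ℕ) : ¬ Above α α := by
  rintro ⟨-, h | h⟩
  · exact h.1 rfl
  · exact h.2.1 rfl

theorem sum_sorted {M : Type*} [AddCommMonoid M] (α : Fin N → ℕ) (g : ℕ → M) :
    ∑ i, g (sorted α i) = ∑ i, g (α i) := by
  obtain ⟨_, w, hw⟩ := sorted_spec α
  rw [hw]
  exact Equiv.sum_comp w (fun i => g (α i))

theorem sorted_comp (α : Fin N → ℕ) (w : Equiv.Perm (Fin N)) : sorted (α ∘ w) = sorted α := by
  refine eq_of_partial_sums_eq fun j => le_antisymm ?_ ?_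
  · obtain ⟨S, hS, h⟩ := exists_sum_eq_sorted (α ∘ w) j
    rw [← h]
    refine le_trans (le_of_eq ?_) (sum_le_sorted α j (S := S.map w.toEmbedding) (by simpa using hS))
    simp
  · obtain ⟨S, hS, h⟩ := exists_sum_eq_sorted α j
    rw [← h]
    refine le_trans (le_of_eq ?_)
      (sum_le_sorted (α ∘ w) j (S := S.map w.symm.toEmbedding) (by simpa using hS))
    simp

theorem above_sorted {α : Fin N → ℕ} (h : sorted α ≠ α) : Above (sorted α) α := by
  refine ⟨sum_sorted α id, Or.inr ⟨?_, h, fun j => sum_le_sorted α j rfl⟩⟩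
  obtain ⟨_, w, hw⟩ := sorted_spec α
  conv_lhs => rw [hw]
  exact sorted_comp α w

theorem above_comp_swap {α : Fin N → ℕ} {i j : Fin N} (hij : i < j) (h : α j < α i) :
    Above α (α ∘ Equiv.swap i j) := by
  refine ⟨(Equiv.sum_comp (Equiv.swap i j) α).symm, Or.inr ⟨(sorted_comp _ _).symm, ?_, fun k => ?_⟩⟩
  · intro e
    have := congrFun e i
    simp at this
    omega
  · rcases lt_or_ge k i with hk | hk
    · refine le_of_eq (sum_congr rfl fun p hp => ?_)
      have := (mem_filter.1 hp).2
      rw [Function.comp_apply, Equiv.swap_apply_of_ne_of_ne (by omega) (by omega)]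
    · have hi : i ∈ univ.filter (fun p : Fin N => p ≤ k) := by simpa using hk
      rcases lt_or_ge k j with hk' | hk'
      · refine sum_le_sum fun p hp => ?_
        have := (mem_filter.1 hp).2
        rcases eq_or_ne p i with rfl | hpi
        · simpa using h.le
        · rw [Function.comp_apply, Equiv.swap_apply_of_ne_of_ne hpi (by omega)]
      · refine le_of_eq (sum_equiv (Equiv.swap i j) (fun p => ?_) fun p _ => rfl)
        rcases eq_or_ne p i with rfl | hpi
        · simp [hk, hk']
        · rcases eq_or_ne p j with rfl | hpj
          · simp [hk, hk']
          · rw [Equiv.swap_apply_of_ne_of_ne hpi hpj]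

/-- Moving two entries strictly towards each other lowers a composition. -/
theorem above_of_transfer {α γ : Fin N → ℕ} {i j : Fin N} (hij : i ≠ j)
    (hsum : γ i + γ j = α i + α j) (hγi : γ i < max (α i) (α j)) (hγj : γ j < max (α i) (α j))
    (hrest : ∀ p, p ≠ i → p ≠ j → γ p = α p) : Above α γ := by
  have hsplit : ∀ g : Fin N → ℕ, ∑ p, g p = g i + (g j + ∑ p ∈ (univ.erase i).erase j, g p) := by
    intro g
    rw [add_sum_erase _ _ (by simpa using hij.symm), add_sum_erase _ _ (mem_univ i)]
  have hr : ∀ g : ℕ → ℕ, ∑ p ∈ (univ.erase i).erase j, g (γ p) =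
      ∑ p ∈ (univ.erase i).erase j, g (α p) := fun g =>
    sum_congr rfl fun p hp => by simp at hp; rw [hrest p hp.2 hp.1]
  refine ⟨?_, Or.inl ⟨fun e => ?_, fun k => ?_⟩⟩
  · rw [hsplit α, hsplit γ, hr fun x => x]; omega
  -- The sum of squares depends only on the rearrangement and drops strictly when two entries move
  -- towards each other.
  · have h2 : ∑ p, (α p) ^ 2 = ∑ p, (γ p) ^ 2 := by
      rw [← sum_sorted α (· ^ 2), ← sum_sorted γ (· ^ 2), e]
    rw [hsplit fun p => α p ^ 2, hsplit fun p => γ p ^ 2, hr (· ^ 2)] at h2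
    have h3 : α i ^ 2 + α j ^ 2 = γ i ^ 2 + γ j ^ 2 := by omega
    rcases le_total (α i) (α j) with h | h
    · rw [max_eq_right h] at hγi hγj
      nlinarith
    · rw [max_eq_left h] at hγi hγj
      nlinarith
  -- Take an optimal set `S` for `γ`. If it contains both or neither of `i`, `j`, it serves for `α`
  -- too; if it contains exactly one, use instead the one with the larger entry of `α`.
  · obtain ⟨S, hS, h⟩ := exists_sum_eq_sorted γ k
    rw [← h]
    by_cases hi : i ∈ S <;> by_cases hj : j ∈ S
    · refine le_trans (le_of_eq ?_) (sum_le_sorted α k hS)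
      rw [← add_sum_erase _ _ hi, ← add_sum_erase _ _ hi,
        ← add_sum_erase _ γ (show j ∈ S.erase i by simp [hj, hij.symm]),
        ← add_sum_erase _ α (show j ∈ S.erase i by simp [hj, hij.symm]),
        sum_congr rfl fun p hp => hrest p (by simp at hp; tauto) (by simp at hp; tauto)]
      eta_reduce
      omega
    · rcases le_total (α i) (α j) with hle | hle
      · refine le_trans ?_ (sum_le_sorted α k (S := insert j (S.erase i)) ?_)
        · rw [sum_insert (by simp [hj]), ← add_sum_erase _ _ hi,
            sum_congr rfl fun p hp => hrest p (by simp at hp; tauto)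
              (by simp at hp; exact fun e => hj (e ▸ hp.2))]
          rw [max_eq_right hle] at hγi
          eta_reduce
          omega
        · rw [card_insert_of_notMem (by simp [hj]), card_erase_add_one hi, hS]
      · refine le_trans ?_ (sum_le_sorted α k hS)
        rw [← add_sum_erase _ _ hi, ← add_sum_erase _ _ hi,
            sum_congr rfl fun p hp => hrest p (by simp at hp; tauto)
              (by simp at hp; exact fun e => hj (e ▸ hp.2))]
        rw [max_eq_left hle] at hγi
        eta_reduce
        omega
    · rcases le_total (α i) (α j) with hle | hle
      · refine le_trans ?_ (sum_le_sorted α k hS)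
        rw [← add_sum_erase _ _ hj, ← add_sum_erase _ _ hj,
            sum_congr rfl fun p hp => hrest p (by simp at hp; exact fun e => hi (e ▸ hp.2))
              (by simp at hp; tauto)]
        rw [max_eq_right hle] at hγj
        eta_reduce
        omega
      · refine le_trans ?_ (sum_le_sorted α k (S := insert i (S.erase j)) ?_)
        · rw [sum_insert (by simp [hi]), ← add_sum_erase _ _ hj,
            sum_congr rfl fun p hp => hrest p (by simp at hp; exact fun e => hi (e ▸ hp.2))
              (by simp at hp; tauto)]
          rw [max_eq_left hle] at hγj
          eta_reduce
          omega
        · rw [card_insert_of_notMem (by simp [hi]), card_erase_add_one hj, hS]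
    · refine le_trans (le_of_eq ?_) (sum_le_sorted α k hS)
      exact sum_congr rfl fun p hp => hrest p (fun e => hi (e ▸ hp)) (fun e => hj (e ▸ hp))

theorem finite_setOf_sum_eq (d : ℕ) : {β : Fin N →₀ ℕ | ∑ i, β i = d}.Finite := by
  refine Set.Finite.of_injOn (f := fun β : Fin N →₀ ℕ => (β : Fin N → ℕ))
    (t := Set.Iic fun _ => d) ?_ (DFunLike.coe_injective.injOn) (Set.finite_Iic _)
  intro β hβ i
  exact (single_le_sum (f := fun i => β i) (fun _ _ => Nat.zero_le _) (mem_univ i)).trans_eq hβ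

/-- Only finitely many compositions have a given sum, and `▷` preserves the sum. -/
theorem exists_isMaximalIn_above {S : Set (Fin N →₀ ℕ)} {β : Fin N →₀ ℕ} (hβ : β ∈ S) :
    ∃ γ, IsMaximalIn S γ ∧ (γ = β ∨ Above γ β) := by
  let R : (Fin N →₀ ℕ) → (Fin N →₀ ℕ) → Prop := fun x y => Above x y
  have hR : IsStrictOrder (Fin N →₀ ℕ) R :=
    { irrefl := fun a => not_above_self a
      trans := fun a b c => Above.trans }
  have hfin : (S ∩ {γ : Fin N →₀ ℕ | γ = β ∨ Above γ β}).Finite := by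
    refine (finite_setOf_sum_eq (∑ i, β i)).subset ?_
    rintro γ ⟨-, rfl | h⟩
    · rfl
    · exact h.1
  obtain ⟨γ, hγ, hmax⟩ := (Set.Finite.wellFoundedOn (r := R) hfin).has_min (Set.univ)
    ⟨⟨β, hβ, Or.inl rfl⟩, trivial⟩
  refine ⟨γ, ⟨γ.2.1, fun δ hδ h => hmax ⟨δ, hδ, Or.inr ?_⟩ trivial h⟩, γ.2.2⟩
  rcases γ.2.2 with e | e
  · rw [← e]; exact h
  · exact h.trans e

end Orders

/-! ### Triangularity of `U_i` -/

section Triangularity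

variable {K : Type*} [Field K] {N : ℕ}

/-- Intermediate monomials of the divided difference are transfers, hence lower. For `α j > α i` the
swapped monomial occurs with coefficient `-1`: the transposition cancels it when `i < j`, and it is
lower when `j < i`. For `α j < α i` it can only come from the transposition with `i < j`, and is
again lower. -/
theorem coeff_pairTerm_monomial {i j : Fin N} (hij : i ≠ j) (α γ : Fin N →₀ ℕ)
    (h : ¬ Above α γ) :
    (X i * divDiff i j (monomial α (1 : K)) +
      if i < j then permRep K N (Equiv.swap i j) (monomial α 1) else 0).coeff γ =
    if α = γ then (if α j < α i ∨ (i < j ∧ α j = α i) then 1 else 0) else 0 := by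
  have hself : ∀ t : ℕ, (α.update i t).update j (α i + α j - t) = α ↔ t = α i := by
    intro t
    constructor
    · intro e
      have := DFunLike.congr_fun e i
      simpa [hij] using this
    · rintro rfl
      ext p
      rcases eq_or_ne p j with rfl | hj
      · simp
      · rcases eq_or_ne p i with rfl | hi <;> simp [*]
  have hmid : ∀ t : ℕ, t < max (α i) (α j) → α i + α j - t < max (α i) (α j) →
      (α.update i t).update j (α i + α j - t) ≠ γ := by
    rintro t ht ht' rfl
    refine h (above_of_transfer hij ?_ ?_ ?_ ?_)
    · simp [hij]
      have := max_le_add_of_nonneg (Nat.zero_le (α i)) (Nat.zero_le (α j))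
      omega
    · simpa [hij] using ht
    · simpa [hij] using ht'
    · intro p hp hp'
      simp [hp, hp']
  have hsw : ∀ t, t = α j → (α.update i t).update j (α i + α j - t) =
      permExp (Equiv.swap i j) α := by
    rintro t rfl
    ext p
    rcases eq_or_ne p j with rfl | hj
    · simp
    · rcases eq_or_ne p i with rfl | hi
      · simp [hj]
      · simp [hj, hi, Equiv.swap_apply_of_ne_of_ne]
  have hswne : i < j → α j < α i → permExp (Equiv.swap i j) α ≠ γ := by
    rintro h1 h2 rfl
    refine h ?_
    convert above_comp_swap h1 h2 using 1
    funext p; simp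
  have hswne' : j < i → α i < α j → permExp (Equiv.swap i j) α ≠ γ := by
    rintro h1 h2 rfl
    refine h ?_
    convert above_comp_swap h1 h2 using 1
    funext p; simp [Equiv.swap_comm]
  have hsweq : α i = α j → permExp (Equiv.swap i j) α = α := by
    intro e
    rw [← hsw _ rfl, hself, e]
  have hperm : (if i < j then permRep K N (Equiv.swap i j) (monomial α (1 : K)) else 0).coeff γ =
      if i < j ∧ permExp (Equiv.swap i j) α = γ then 1 else 0 := by
    split_ifs with h1 h2 h2
    · rw [permRep_monomial, Equiv.swap_inv, coeff_monomial, if_pos h2.2]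
    · rw [permRep_monomial, Equiv.swap_inv, coeff_monomial, if_neg fun e => h2 ⟨h1, e⟩]
    · exact absurd h2.1 h1
    · simp
  rw [coeff_add, hperm]
  rcases lt_trichotomy (α j) (α i) with hlt | heq | hgt
  · rw [X_mul_divDiff_monomial_of_le hij hlt.le, coeff_sum]
    have : ∀ s ∈ range (α i - α j),
        (monomial ((α.update i (α j + 1 + s)).update j (α i - 1 - s)) (1 : K)).coeff γ =
        if s = α i - α j - 1 then (if α = γ then 1 else 0) else 0 := by
      intro s hs
      rw [mem_range] at hs
      have e1 : α i - 1 - s = α i + α j - (α j + 1 + s) := by omega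
      rw [e1, coeff_monomial]
      by_cases hs' : s = α i - α j - 1
      · rw [if_pos hs', (hself _).2 (by omega)]
      · rw [if_neg hs', if_neg (hmid _ (by rw [max_eq_left hlt.le]; omega)
          (by rw [max_eq_left hlt.le]; omega))]
    rw [sum_congr rfl this, sum_ite_eq' (range (α i - α j)), if_pos (by rw [mem_range]; omega),
      if_neg (show ¬ (i < j ∧ permExp (Equiv.swap i j) α = γ) from fun h1 => hswne h1.1 hlt h1.2)]
    simp [hlt]
  · rw [X_mul_divDiff_monomial_of_le hij heq.le, heq, Nat.sub_self, sum_range_zero, coeff_zero,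
      zero_add, hsweq heq.symm]
    by_cases e : α = γ <;> by_cases h1 : i < j <;> simp [e, h1]
  · rw [X_mul_divDiff_monomial_of_ge hij hgt.le, coeff_neg, coeff_sum]
    have : ∀ s ∈ range (α j - α i),
        (monomial ((α.update i (α i + 1 + s)).update j (α j - 1 - s)) (1 : K)).coeff γ =
        if s = α j - α i - 1 then (if permExp (Equiv.swap i j) α = γ then 1 else 0) else 0 := by
      intro s hs
      rw [mem_range] at hs
      have e1 : α j - 1 - s = α i + α j - (α i + 1 + s) := by omega
      rw [e1, coeff_monomial]
      by_cases hs' : s = α j - α i - 1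
      · rw [if_pos hs', hsw _ (by omega)]
      · rw [if_neg hs', if_neg (hmid _ (by rw [max_eq_right hgt.le]; omega)
          (by rw [max_eq_right hgt.le]; omega))]
    rw [sum_congr rfl this, sum_ite_eq' (range (α j - α i)), if_pos (by rw [mem_range]; omega)]
    rcases lt_or_gt_of_ne hij with h1 | h1
    · simp [h1, hgt.not_gt, hgt.ne']
    · simp [h1.not_gt, hgt.not_gt, hswne' h1 hgt]

/-- The indices `j` with diagonal contribution `1` are those that the rank does not count, so there
are `N - r(α, i)` of them: the coefficient of `κ` in `ξ_i`. -/
theorem card_lt_add_card_eq (α : Fin N → ℕ) (i : Fin N) :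
    rank α i + (univ.filter (fun j => j ≠ i ∧ (α j < α i ∨ (i < j ∧ α j = α i)))).card = N := by
  have h : ((univ.filter (fun j => α i < α j)) ∪ (univ.filter (fun j => j ≤ i ∧ α j = α i))) ∪
      (univ.filter (fun j => j ≠ i ∧ (α j < α i ∨ (i < j ∧ α j = α i)))) = univ := by
    ext j
    simp only [mem_union, mem_filter, mem_univ, true_and, iff_true]
    rcases eq_or_ne j i with rfl | hj
    · simp
    · rcases lt_trichotomy (α i) (α j) with h | h | h
      · simp [h]
      · rcases lt_or_gt_of_ne hj with h' | h' <;> simp [h.symm, h'.le, h', hj]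
      · simp [h, hj]
  have h2 := congrArg card h
  rw [card_univ, Fintype.card_fin] at h2
  rw [rank]
  refine Eq.trans ?_ h2
  rw [card_union_of_disjoint, card_union_of_disjoint]
  · rw [disjoint_filter]; rintro j - h1 h2; omega
  · rw [disjoint_left]
    intro j
    simp only [mem_union, mem_filter, mem_univ, true_and, not_and, not_or]
    rintro (h1 | h1) <;> intros <;> constructor <;> omega

theorem opU_monomial_coeff (κ : K) (i : Fin N) (α γ : Fin N →₀ ℕ) (h : ¬ Above α γ) :
    (opU κ i (monomial α (1 : K))).coeff γ = if α = γ then xi κ γ i else 0 := by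
  have hU : opU κ i (monomial α (1 : K)) =
      X i * pderiv i (monomial α 1) + monomial α 1 +
      κ • ∑ j ∈ univ.filter (fun j => j ≠ i), (X i * divDiff i j (monomial α (1 : K)) +
        if i < j then permRep K N (Equiv.swap i j) (monomial α 1) else 0) := by
    rw [opU_eq, dunkl, sum_add_distrib, ← mul_sum, ← sum_filter, filter_filter]
    have : univ.filter (fun j => j ≠ i ∧ i < j) = univ.filter (fun j => i < j) := by
      ext j; simp; exact fun h => h.ne'
    rw [this, mul_add, mul_smul_comm, smul_add]
    abel
  have hd : X i * pderiv i (monomial α (1 : K)) = monomial α (α i : K) := by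
    rw [pderiv_monomial, X, monomial_mul, one_mul, one_mul]
    by_cases h0 : α i = 0
    · simp [h0]
    · congr 2
      ext p
      rcases eq_or_ne p i with rfl | hp
      · simp; omega
      · simp [hp]
  rw [hU, hd, coeff_add, coeff_add, coeff_smul, coeff_sum, coeff_monomial, coeff_monomial,
    sum_congr rfl fun j hj => coeff_pairTerm_monomial (mem_filter.1 hj).2.symm α γ h]
  split_ifs with e
  · subst e
    have hc := card_lt_add_card_eq α i
    rw [← sum_filter, filter_filter, sum_const, nsmul_eq_mul, xi]
    have : ((univ.filter (fun j => j ≠ i ∧ (α j < α i ∨ (i < j ∧ α j = α i)))).card : K) =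
        (N : K) - (rank α i : K) := by
      rw [eq_sub_iff_add_eq', ← Nat.cast_add]
      exact congrArg _ hc
    rw [this, smul_eq_mul]
    ring
  · simp

theorem opU_add (κ : K) (i : Fin N) (f g : MvPolynomial (Fin N) K) :
    opU κ i (f + g) = opU κ i f + opU κ i g := by
  simp only [opU_eq, dunkl_add, map_add, sum_add_distrib, smul_add, mul_add]
  abel

theorem opU_smul (κ : K) (i : Fin N) (c : K) (f : MvPolynomial (Fin N) K) :
    opU κ i (c • f) = c • opU κ i f := by
  simp only [opU_eq, dunkl_smul, map_smul, ← smul_sum, smul_add, mul_smul_comm, smul_comm κ c]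

/-- `U_i` is triangular with respect to `▷`. -/
theorem coeff_opU_of_isMaximalIn (κ : K) (i : Fin N) {f : MvPolynomial (Fin N) K}
    {γ : Fin N →₀ ℕ} (h : ∀ β ∈ f.support, ¬ Above β γ) :
    (opU κ i f).coeff γ = xi κ γ i * f.coeff γ := by
  let U : MvPolynomial (Fin N) K →ₗ[K] MvPolynomial (Fin N) K :=
    { toFun := opU κ i
      map_add' := opU_add κ i
      map_smul' := opU_smul κ i }
  have hf : f = ∑ β ∈ f.support, f.coeff β • monomial β (1 : K) := by
    conv_lhs => rw [f.as_sum]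
    exact sum_congr rfl fun β _ => by rw [smul_monomial, smul_eq_mul, mul_one]
  have h1 : opU κ i f = ∑ β ∈ f.support, f.coeff β • opU κ i (monomial β (1 : K)) := by
    change U f = ∑ β ∈ f.support, f.coeff β • U (monomial β (1 : K))
    conv_lhs => rw [hf]
    rw [map_sum]
    exact sum_congr rfl fun β _ => map_smul _ _ _
  rw [h1, coeff_sum]
  rw [sum_congr rfl fun β hβ => by
    rw [coeff_smul, opU_monomial_coeff κ i β γ (h β hβ), smul_eq_mul, mul_ite, mul_zero]]
  rw [sum_ite_eq' f.support]
  split_ifs with hγ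
  · ring
  · rw [notMem_support_iff.1 hγ, mul_zero]

end Triangularity

/-! ### A vanishing lemma for functions on finite sets -/

section SetFunctions

/-- A function on finite sets whose sums over one-point extensions all vanish is zero on every set
that is larger than its complement. -/
theorem eq_zero_of_sum_insert_eq_zero {ι K : Type*} [DecidableEq ι] [Field K] [CharZero K]
    {X : Finset ι} {G : Finset ι → K} (hG : ∀ C ⊆ X, ∑ q ∈ X \ C, G (insert q C) = 0)
    {B : Finset ι} (hB : B ⊆ X) (hc : (X \ B).card < B.card) : G B = 0 := by
  set b := B.card with hb
  let F : Finset (Finset ι) := powersetCard b X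
  -- Sums over the `b`-sets containing `P` vanish whenever `P` has fewer than `b` elements; `k + 1`
  -- is the number of missing elements.
  have h1 : ∀ k : ℕ, ∀ P ⊆ X, P.card + (k + 1) = b →
      ∑ D ∈ F.filter (fun D => P ⊆ D), G D = 0 := by
    intro k
    induction k with
    | zero =>
      intro P hP hk
      rw [← hG P hP]
      symm
      refine sum_bij (fun q _ => insert q P) ?_ ?_ ?_ ?_
      · intro q hq
        rw [mem_sdiff] at hq
        simp only [F, mem_filter, mem_powersetCard]
        exact ⟨⟨insert_subset hq.1 hP, by rw [card_insert_of_notMem hq.2]; omega⟩,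
          subset_insert _ _⟩
      · intro q hq q' hq' e
        rw [mem_sdiff] at hq hq'
        have : q ∈ insert q' P := e ▸ mem_insert_self q P
        exact (mem_insert.1 this).resolve_right hq.2
      · intro D hD
        simp only [F, mem_filter, mem_powersetCard] at hD
        have hcard : (D \ P).card = 1 := by
          have := card_sdiff_add_card_eq_card hD.2
          omega
        obtain ⟨q, hq⟩ := card_eq_one.1 hcard
        have hq' : q ∈ D \ P := hq ▸ mem_singleton_self q
        rw [mem_sdiff] at hq'
        refine ⟨q, mem_sdiff.2 ⟨hD.1.1 hq'.1, hq'.2⟩, ?_⟩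
        rw [← sdiff_union_of_subset hD.2, hq, insert_eq]
      · intro q _
        rfl
    | succ k ih =>
      intro P hP hk
      -- Double counting: summing over one further element `x` counts each `D` exactly `k + 2`
      -- times, and this number is invertible in characteristic zero.
      have h2 : ∑ x ∈ X \ P, ∑ D ∈ F.filter (fun D => insert x P ⊆ D), G D = 0 :=
        sum_eq_zero fun x hx => by
          rw [mem_sdiff] at hx
          exact ih _ (insert_subset hx.1 hP) (by rw [card_insert_of_notMem hx.2]; omega)
      have h3 : ∑ x ∈ X \ P, ∑ D ∈ F.filter (fun D => insert x P ⊆ D), G D =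
          ∑ D ∈ F.filter (fun D => P ⊆ D), ∑ x ∈ D \ P, G D := by
        refine sum_comm' fun x D => ?_
        simp only [F, mem_sdiff, mem_filter, mem_powersetCard, insert_subset_iff]
        constructor
        · rintro ⟨⟨h1, h2⟩, h3, h4, h5⟩
          exact ⟨⟨h4, h2⟩, h3, h5⟩
        · rintro ⟨⟨h4, h2⟩, h3, h5⟩
          exact ⟨⟨h3.1 h4, h2⟩, h3, h4, h5⟩
      have h4 : ∑ D ∈ F.filter (fun D => P ⊆ D), ∑ x ∈ D \ P, G D =
          ((k + 2 : ℕ) : K) * ∑ D ∈ F.filter (fun D => P ⊆ D), G D := by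
        rw [mul_sum]
        refine sum_congr rfl fun D hD => ?_
        simp only [F, mem_filter, mem_powersetCard] at hD
        have : (D \ P).card = k + 2 := by
          have := card_sdiff_add_card_eq_card hD.2
          omega
        rw [sum_const, this, nsmul_eq_mul]
      rw [h3, h4] at h2
      exact (mul_eq_zero.1 h2).resolve_left (Nat.cast_ne_zero.2 (by omega))
  -- Inclusion–exclusion: an element to be avoided is traded for one to be contained, so only
  -- `P.card + Q.card` matters.
  have h2 : ∀ Q ⊆ X, ∀ P ⊆ X, Disjoint P Q → P.card + Q.card < b →
      ∑ D ∈ F.filter (fun D => P ⊆ D ∧ Disjoint D Q), G D = 0 := by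
    intro Q
    induction Q using Finset.induction_on with
    | empty =>
      intro _ P hP _ hlt
      simpa using h1 (b - P.card - 1) P hP (by simp at hlt; omega)
    | insert x Q hx ih =>
      intro hQ P hP hd hlt
      rw [card_insert_of_notMem hx] at hlt
      rw [insert_subset_iff] at hQ
      rw [disjoint_insert_right] at hd
      have e1 := ih hQ.2 P hP hd.2 (by omega)
      have e2 := ih hQ.2 (insert x P) (insert_subset hQ.1 hP)
        (disjoint_insert_left.2 ⟨hx, hd.2⟩) (by rw [card_insert_of_notMem hd.1]; omega)
      rw [← sum_filter_add_sum_filter_not _ (fun D => x ∈ D), filter_filter, filter_filter] at e1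
      have s1 : F.filter (fun D => (P ⊆ D ∧ Disjoint D Q) ∧ x ∈ D) =
          F.filter (fun D => insert x P ⊆ D ∧ Disjoint D Q) :=
        filter_congr fun D _ => by rw [insert_subset_iff]; tauto
      have s2 : F.filter (fun D => (P ⊆ D ∧ Disjoint D Q) ∧ x ∉ D) =
          F.filter (fun D => P ⊆ D ∧ Disjoint D (insert x Q)) :=
        filter_congr fun D _ => by rw [disjoint_insert_right]; tauto
      rwa [s1, s2, e2, zero_add] at e1
  -- A `b`-subset of `X` avoiding `X \ B` can only be `B`, so the sum reduces to `G B`.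
  have h3 := h2 (X \ B) sdiff_subset ∅ (empty_subset _) (disjoint_empty_left _) (by simpa using hc)
  have h4 : F.filter (fun D => ∅ ⊆ D ∧ Disjoint D (X \ B)) = {B} := by
    ext D
    simp only [F, mem_filter, mem_powersetCard, mem_singleton, empty_subset, true_and]
    constructor
    · rintro ⟨⟨h5, h6⟩, h7⟩
      refine eq_of_subset_of_card_le (fun x hx => ?_) (by omega)
      by_contra hxB
      exact disjoint_left.1 h7 hx (mem_sdiff.2 ⟨h5 hx, hxB⟩)
    · rintro rfl
      exact ⟨⟨hB, rfl⟩, disjoint_sdiff⟩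
  rwa [h4, sum_singleton] at h3

end SetFunctions

/-! ### Highest weight vectors: Murphy elements and lexicographic leading words -/

section HighestWeight

variable {K : Type*} [Field K] {N : ℕ}

/-- `f` is annihilated by all operators that replace an exponent `m` by a smaller exponent `j`. -/
def IsHighestWeight (f : MvPolynomial (Fin N) K) : Prop :=
  ∀ j m : ℕ, j < m → ∀ β : Fin N →₀ ℕ,
    ∑ q ∈ univ.filter (fun q => β q = j), f.coeff (β.update q m) = 0

/-- All exponents of `f` have `τ r` entries equal to `r`. -/
def HasWeight (τ : Fin N → ℕ) (f : MvPolynomial (Fin N) K) : Prop :=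
  ∀ β, f.coeff β ≠ 0 → ∀ r : Fin N, (univ.filter (fun q => β q = (r : ℕ))).card = τ r

/-- All exponents of `f` are lexicographically at most `α`. -/
def LexBounded (f : MvPolynomial (Fin N) K) (α : Fin N →₀ ℕ) : Prop :=
  ∀ β, f.coeff β ≠ 0 → toLex β ≤ toLex α

/-- The content `#{q > p : α_q = α_p} - α_p` of the position `p` of `α`. -/
def expContent (α : Fin N → ℕ) (p : Fin N) : ℤ :=
  ((univ.filter (fun q => p < q ∧ α q = α p)).card : ℤ) - (α p : ℤ)

/-- Every final segment of `α` has at least as many entries `r` as entries `r + 1`. -/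
def IsLattice (α : Fin N → ℕ) : Prop :=
  ∀ (p : Fin N) (r : ℕ), (univ.filter (fun q => p ≤ q ∧ α q = r + 1)).card ≤
    (univ.filter (fun q => p ≤ q ∧ α q = r)).card

theorem LexBounded.coeff_eq_zero {f : MvPolynomial (Fin N) K} {α β : Fin N →₀ ℕ}
    (hf : LexBounded f α) (t : Fin N) (h : ∀ s < t, α s = β s) (ht : α t < β t) :
    f.coeff β = 0 := by
  by_contra h0
  exact not_lt_of_ge (hf β h0) (Finsupp.Lex.lt_iff.2 ⟨t, h, ht⟩)

theorem permExp_swap_eq_update (β : Fin N →₀ ℕ) {p q : Fin N} :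
    permExp (Equiv.swap p q) β = (β.update p (β q)).update q (β p) := by
  ext s
  rcases eq_or_ne s q with rfl | hs
  · simp
  · rcases eq_or_ne s p with rfl | hs'
    · simp [hs]
    · simp [hs, hs', Equiv.swap_apply_of_ne_of_ne]

theorem coeff_murphy_of_prefix {f : MvPolynomial (Fin N) K} (hf : IsHighestWeight f)
    {α β : Fin N →₀ ℕ} (hb : LexBounded f α) (p : Fin N) (hpre : ∀ s < p, β s = α s)
    (hp : α p ≤ β p) :
    (murphy p.rev f).coeff β = (expContent β p : K) * f.coeff β := by
  -- The highest weight equation for `β` with the letter at `p` lowered to `j`: position `p` returns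
  -- `β`, positions before `p` give words above the lexicographic bound, and positions after `p`
  -- give the exchanges wanted.
  have hterm : ∀ j < β p, ∑ q ∈ univ.filter (fun q => p < q ∧ β q = j),
      f.coeff ((β.update p j).update q (β p)) = - f.coeff β := by
    intro j hj
    have h := hf j (β p) hj (β.update p j)
    rw [← add_sum_erase _ _ (show p ∈ univ.filter (fun q => β.update p j q = j) by simp)] at h
    have hsub : univ.filter (fun q => p < q ∧ β q = j) ⊆
        (univ.filter (fun q => β.update p j q = j)).erase p := by
      intro q hq
      simp only [mem_filter, mem_univ, true_and, mem_erase] at hq ⊢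
      refine ⟨hq.1.ne', ?_⟩
      simp [hq.1.ne', hq.2]
    rw [← sum_subset hsub] at h
    · have e : (β.update p j).update p (β p) = β := by ext s; by_cases hs : s = p <;> simp [hs]
      rw [e] at h
      exact eq_neg_of_add_eq_zero_right h
    · intro q hq hq'
      simp only [mem_filter, mem_univ, true_and, mem_erase] at hq hq'
      have hqp : q < p := by
        rcases lt_trichotomy q p with h1 | h1 | h1
        · exact h1
        · exact absurd h1 hq.1
        · refine absurd ⟨h1, ?_⟩ hq'
          simpa [h1.ne'] using hq.2
      refine hb.coeff_eq_zero q (fun s hs => ?_) ?_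
      · have h1 : s ≠ p := (hs.trans hqp).ne
        simp [hs.ne, h1, hpre s (hs.trans hqp)]
      · have h2 : β q = j := by simpa [hqp.ne] using hq.2
        simp only [Finsupp.coe_update, Function.update_self]
        rw [← hpre q hqp, h2]
        exact hj
  have hsum : (murphy p.rev f).coeff β = ∑ q ∈ univ.filter (fun q => p < q),
      f.coeff ((β.update p (β q)).update q (β p)) := by
    rw [murphy_rev, coeff_sum]
    refine sum_congr rfl fun q hq => ?_
    rw [coeff_permRep, permExp_swap_eq_update]
  rw [hsum, ← sum_filter_add_sum_filter_not _ (fun q => β q < β p), filter_filter, filter_filter,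
    ← sum_filter_add_sum_filter_not (univ.filter fun q => p < q ∧ ¬ β q < β p)
      (fun q => β q = β p), filter_filter, filter_filter]
  -- Each of the `β p` smaller letters contributes `-1`. Equal letters contribute `+1` per position,
  -- and larger letters exceed the bound at `p`.
  have s1 : ∑ q ∈ univ.filter (fun q => p < q ∧ β q < β p),
      f.coeff ((β.update p (β q)).update q (β p)) = - (β p : K) * f.coeff β := by
    rw [← sum_fiberwise_of_maps_to (t := range (β p)) (g := fun q => β q)
      (fun q hq => by simpa using (mem_filter.1 hq).2.2)]
    have : ∀ j ∈ range (β p), ∑ q ∈ (univ.filter (fun q => p < q ∧ β q < β p)).filter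
        (fun q => β q = j), f.coeff ((β.update p (β q)).update q (β p)) = - f.coeff β := by
      intro j hj
      rw [mem_range] at hj
      rw [← hterm j hj, filter_filter]
      refine sum_congr (filter_congr fun q _ => ?_) fun q hq => ?_
      · constructor
        · rintro ⟨⟨h1, h2⟩, h3⟩; exact ⟨h1, h3⟩
        · rintro ⟨h1, h3⟩; exact ⟨⟨h1, h3 ▸ hj⟩, h3⟩
      · rw [(mem_filter.1 hq).2.2]
    rw [sum_congr rfl this, sum_const, card_range, nsmul_eq_mul]
    ring
  have s2 : ∑ q ∈ univ.filter (fun q => (p < q ∧ ¬ β q < β p) ∧ β q = β p),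
      f.coeff ((β.update p (β q)).update q (β p)) =
      ((univ.filter (fun q => p < q ∧ β q = β p)).card : K) * f.coeff β := by
    have e : univ.filter (fun q => (p < q ∧ ¬ β q < β p) ∧ β q = β p) =
        univ.filter (fun q => p < q ∧ β q = β p) := filter_congr fun q _ => by
      constructor
      · rintro ⟨⟨h1, h2⟩, h3⟩; exact ⟨h1, h3⟩
      · rintro ⟨h1, h3⟩; exact ⟨⟨h1, by omega⟩, h3⟩
    rw [e, ← nsmul_eq_mul, ← sum_const]
    refine sum_congr rfl fun q hq => ?_
    have hq := (mem_filter.1 hq).2.2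
    congr 1
    ext s
    by_cases h1 : s = q
    · simp [h1, hq]
    · by_cases h2 : s = p
      · subst h2; simp [h1, hq]
      · simp [h1, h2]
  have s3 : ∑ q ∈ univ.filter (fun q => (p < q ∧ ¬ β q < β p) ∧ ¬ β q = β p),
      f.coeff ((β.update p (β q)).update q (β p)) = 0 := by
    refine sum_eq_zero fun q hq => ?_
    obtain ⟨⟨h1, h2⟩, h3⟩ := (mem_filter.1 hq).2
    refine hb.coeff_eq_zero p (fun s hs => ?_) ?_
    · simp [hs.ne, (hs.trans h1).ne, hpre s hs]
    · simp [h1.ne]; omega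
  rw [s1, s2, s3, expContent]
  push_cast
  ring

/-- On highest weight vectors the Murphy elements act lexicographically triangularly. -/
theorem coeff_murphy_of_le {f : MvPolynomial (Fin N) K} (hf : IsHighestWeight f)
    {α β : Fin N →₀ ℕ} (hb : LexBounded f α) (hle : toLex α ≤ toLex β) (p : Fin N) :
    (murphy p.rev f).coeff β = (expContent α p : K) * f.coeff β := by
  rcases hle.eq_or_lt with h | h
  · obtain rfl : α = β := toLex.injective h
    exact coeff_murphy_of_prefix hf hb p (fun _ _ => rfl) le_rfl
  · have h0 : f.coeff β = 0 := by
      by_contra h0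
      exact not_lt_of_ge (hb β h0) h
    rw [h0, mul_zero]
    obtain ⟨t, h1, h2⟩ := Finsupp.Lex.lt_iff.1 h
    simp only [ofLex_toLex] at h1 h2
    -- If `β` first exceeds `α` before `p`, exchanging later positions leaves that excess in place.
    -- Otherwise the prefix formula applies, with the coefficient at `β` equal to zero.
    rcases lt_or_ge t p with htp | htp
    · rw [murphy_rev, coeff_sum]
      refine sum_eq_zero fun q hq => ?_
      have hq := (mem_filter.1 hq).2
      rw [coeff_permRep]
      refine hb.coeff_eq_zero t (fun s hs => ?_) ?_
      · rw [permExp_apply, Equiv.swap_apply_of_ne_of_ne (by omega) (by omega)]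
        exact h1 s hs
      · rw [permExp_apply, Equiv.swap_apply_of_ne_of_ne (by omega) (by omega)]
        exact h2
    · rw [coeff_murphy_of_prefix hf hb p (fun s hs => (h1 s (by omega)).symm), h0, mul_zero]
      rcases htp.eq_or_lt with rfl | h3
      · exact h2.le
      · exact (h1 p h3).le

/-- Redistribute the letters `r` and `r + 1` over the positions from `p` on that carry them. The
coefficient becomes a function of the set of places of `r + 1`, and the highest weight equations
make its one-point extension sums vanish, since changes before `p` exceed the leading word. An
excess of `r + 1` would then kill the leading coefficient. -/
theorem isLattice_of_isHighestWeight [CharZero K] {f : MvPolynomial (Fin N) K}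
    (hf : IsHighestWeight f) {α : Fin N →₀ ℕ} (hb : LexBounded f α) (h0 : f.coeff α ≠ 0) :
    IsLattice α := by
  intro p r
  by_contra hlt
  rw [not_le] at hlt
  apply h0
  let X : Finset (Fin N) := univ.filter (fun q => p ≤ q ∧ (α q = r ∨ α q = r + 1))
  let A : Finset (Fin N) → (Fin N →₀ ℕ) := fun C => Finsupp.equivFunOnFinite.symm fun q =>
    if q ∈ X then (if q ∈ C then r + 1 else r) else α q
  have hA : ∀ C q, A C q = if q ∈ X then (if q ∈ C then r + 1 else r) else α q := fun C q => rfl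
  let B : Finset (Fin N) := univ.filter (fun q => p ≤ q ∧ α q = r + 1)
  have hBX : B ⊆ X := fun q hq => by
    simp only [B, X, mem_filter, mem_univ, true_and] at hq ⊢
    exact ⟨hq.1, Or.inr hq.2⟩
  have hXB : X \ B = univ.filter (fun q => p ≤ q ∧ α q = r) := by
    ext q
    simp only [B, X, mem_sdiff, mem_filter, mem_univ, true_and]
    constructor
    · rintro ⟨⟨h1, h2⟩, h3⟩
      exact ⟨h1, h2.resolve_right fun h => h3 ⟨h1, h⟩⟩
    · rintro ⟨h1, h2⟩
      exact ⟨⟨h1, Or.inl h2⟩, fun h => by omega⟩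
  have hAB : A B = α := by
    ext q
    rw [hA]
    split_ifs with h1 h2
    · simp only [B, mem_filter] at h2; exact h2.2.2.symm
    · have : q ∈ X \ B := mem_sdiff.2 ⟨h1, h2⟩
      rw [hXB] at this
      exact (mem_filter.1 this).2.2.symm
    · rfl
  have key := eq_zero_of_sum_insert_eq_zero (X := X) (G := fun C => f.coeff (A C)) ?_ hBX
    (by rw [hXB]; exact hlt)
  · simpa only [hAB] using key
  · intro C hC
    rw [← hf r (r + 1) (Nat.lt_succ_self r) (A C)]
    have hsub : X \ C ⊆ univ.filter (fun q => A C q = r) := by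
      intro q hq
      rw [mem_sdiff] at hq
      simp [hA, hq.1, hq.2]
    rw [← sum_subset hsub]
    · refine sum_congr rfl fun q hq => ?_
      rw [mem_sdiff] at hq
      congr 1
      ext s
      by_cases hs : s = q
      · subst hs; simp [hA, hq.1]
      · simp [hA, hs]
    · intro q hq hq'
      have hq1 := (mem_filter.1 hq).2
      have hqX : q ∉ X := by
        intro h
        refine hq' (mem_sdiff.2 ⟨h, fun hC' => ?_⟩)
        rw [hA, if_pos h, if_pos hC'] at hq1
        omega
      have hα : α q = r := by rw [hA, if_neg hqX] at hq1; exact hq1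
      have hqp : q < p := by
        by_contra hqp
        exact hqX (by simp [X, hα, not_lt.1 hqp])
      refine hb.coeff_eq_zero q (fun s hs => ?_) (by simp [hα])
      have hsX : s ∉ X := by
        simp only [X, mem_filter, mem_univ, true_and, not_and]
        intro h
        omega
      simp [hs.ne, hA, hsX]

end HighestWeight

/-! ### Specht polynomials are highest weight vectors of weight `τ` -/

section Specht

variable {K : Type*} [Field K] {N : ℕ} {τ : Fin N → ℕ}

theorem tableau_ext (T : Tableau τ) {a b : Fin N} (hr : row T a = row T b)
    (hc : col T a = col T b) : a = b := by
  apply T.injective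
  have h1 : (T a).1 = (T b).1 := Fin.ext hr
  revert h1 hc
  unfold col
  generalize T a = x
  generalize T b = y
  obtain ⟨x1, x2⟩ := x
  obtain ⟨y1, y2⟩ := y
  intro hc h1
  obtain rfl : x1 = y1 := h1
  exact congrArg _ (Fin.ext hc)

/-- The number of entries in the column `c` of `T`. -/
def colHeight (T : Tableau τ) (c : ℕ) : ℕ := (univ.filter (fun k => col T k = c)).card

/-- The product over all ordered pairs of distinct entries in a common column is invariant, and
equals the square of the Specht polynomial up to sign. -/
theorem permRep_swap_spechtPoly_sq (T : Tableau τ) {a b : Fin N} (hab : col T a = col T b) :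
    permRep K N (Equiv.swap a b) (spechtPoly K T) = spechtPoly K T ∨
      permRep K N (Equiv.swap a b) (spechtPoly K T) = - spechtPoly K T := by
  set s := Equiv.swap a b with hs
  let P := univ.filter (fun p : Fin N × Fin N => col T p.1 = col T p.2 ∧ row T p.1 < row T p.2)
  let D : MvPolynomial (Fin N) K :=
    ∏ p ∈ univ.filter (fun p : Fin N × Fin N => col T p.1 = col T p.2 ∧ p.1 ≠ p.2),
      (X p.1 - X p.2)
  have hcol : ∀ k, col T (s k) = col T k := by
    intro k
    rcases eq_or_ne k a with rfl | h1
    · rw [hs, Equiv.swap_apply_left, hab]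
    · rcases eq_or_ne k b with rfl | h2
      · rw [hs, Equiv.swap_apply_right, hab]
      · rw [hs, Equiv.swap_apply_of_ne_of_ne h1 h2]
  have hD : permRep K N s D = D := by
    rw [permRep_apply, map_prod]
    refine prod_equiv (s.prodCongr s) (fun p => ?_) fun p _ => by simp
    simp [hcol]
  have hDP : D = spechtPoly K T * ((-1) ^ P.card * spechtPoly K T) := by
    have e1 : univ.filter (fun p : Fin N × Fin N => col T p.1 = col T p.2 ∧ p.1 ≠ p.2) =
        P ∪ P.map (Equiv.prodComm _ _).toEmbedding := by
      ext ⟨p, q⟩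
      simp only [P, mem_union, mem_filter, mem_univ, true_and, mem_map_equiv,
        Equiv.prodComm_symm, Equiv.prodComm_apply, Prod.swap]
      constructor
      · rintro ⟨h1, h2⟩
        rcases lt_trichotomy (row T p) (row T q) with h | h | h
        · exact Or.inl ⟨h1, h⟩
        · exact absurd (tableau_ext T h h1) h2
        · exact Or.inr ⟨h1.symm, h⟩
      · rintro (⟨h1, h2⟩ | ⟨h1, h2⟩)
        · exact ⟨h1, by rintro rfl; exact lt_irrefl _ h2⟩
        · exact ⟨h1.symm, by rintro rfl; exact lt_irrefl _ h2⟩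
    have e2 : Disjoint P (P.map (Equiv.prodComm _ _).toEmbedding) := by
      rw [disjoint_left]
      rintro ⟨p, q⟩ h1 h2
      simp only [P, mem_filter, mem_univ, true_and, mem_map_equiv,
        Equiv.prodComm_symm, Equiv.prodComm_apply, Prod.swap] at h1 h2
      omega
    simp only [D]
    rw [e1, prod_union e2, prod_map]
    congr 1
    rw [spechtPoly, ← prod_const, ← prod_mul_distrib]
    exact prod_congr rfl fun p _ => by simp
  have h2 : permRep K N s (spechtPoly K T) * permRep K N s (spechtPoly K T) =
      spechtPoly K T * spechtPoly K T := by
    have h3 := hD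
    rw [hDP] at h3
    simp only [permRep_apply, map_mul, map_pow, map_neg, map_one] at h3 ⊢
    have h4 : ((-1 : MvPolynomial (Fin N) K) ^ P.card) ≠ 0 := pow_ne_zero _ (by simp)
    apply mul_left_cancel₀ h4
    linear_combination h3
  exact mul_self_eq_mul_self_iff.1 h2

/-- Specht polynomials are alternating in each column. -/
theorem permRep_swap_spechtPoly [CharZero K] (T : Tableau τ) {a b : Fin N} (hne : a ≠ b)
    (hab : col T a = col T b) :
    permRep K N (Equiv.swap a b) (spechtPoly K T) = - spechtPoly K T := by
  wlog hr : row T a < row T b generalizing a b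
  · rw [Equiv.swap_comm]
    refine this hne.symm hab.symm ?_
    rcases lt_trichotomy (row T a) (row T b) with h | h | h
    · exact absurd h hr
    · exact absurd (tableau_ext T h hab) hne
    · exact h
  refine (permRep_swap_spechtPoly_sq T hab).resolve_left fun h => ?_
  let P := univ.filter (fun p : Fin N × Fin N => col T p.1 = col T p.2 ∧ row T p.1 < row T p.2)
  have hP : (a, b) ∈ P := by simp [P, hab, hr]
  let g : MvPolynomial (Fin N) K := ∏ p ∈ P.erase (a, b), (X p.1 - X p.2)
  have hfg : spechtPoly K T = (X a - X b) * g := (mul_prod_erase P _ hP).symm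
  have hX : (X a - X b : MvPolynomial (Fin N) K) ≠ 0 :=
    sub_ne_zero.2 fun e => hne (X_injective e)
  have hg : g + permRep K N (Equiv.swap a b) g = 0 := by
    rw [hfg, permRep_mul_poly, map_sub, permRep_X, permRep_X, Equiv.swap_apply_left,
      Equiv.swap_apply_right] at h
    refine (mul_eq_zero.1 ?_).resolve_left hX
    linear_combination -h
  -- An invariant Specht polynomial would make `g` antisymmetric, so `X a - X b` would divide `2 *
  -- g` although it was already split off.
  have hdiv : (X a - X b) * divDiff a b g = 2 * g := by
    rw [divDiff_spec, eq_neg_of_add_eq_zero_right hg]; ring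
  -- A point whose only coincidence is `y a = y b`; no remaining factor vanishes there.
  let y : Fin N → K := Function.update (fun k => (k : ℕ)) a (b : ℕ)
  have hev := congrArg (eval y) hdiv
  have hya : y a = y b := by simp [y, hne.symm]
  rw [map_mul, map_mul, map_sub, eval_X, eval_X, hya, sub_self, zero_mul, map_ofNat, eq_comm,
    mul_eq_zero, or_iff_right two_ne_zero] at hev
  simp only [g, map_prod, map_sub, eval_X] at hev
  obtain ⟨⟨p, q⟩, hpq, h0⟩ := prod_eq_zero_iff.1 hev
  simp only [P, mem_erase, mem_filter, mem_univ, true_and, ne_eq, Prod.mk.injEq] at hpq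
  have h0 := sub_eq_zero.1 h0
  simp only [y, Function.update_apply] at h0
  split_ifs at h0 with h1 h2 h2
  · subst h1 h2; exact lt_irrefl _ hpq.2.2
  · have : b = q := Fin.ext (Nat.cast_injective h0)
    exact hpq.1 ⟨h1, this.symm⟩
  · have : p = b := Fin.ext (Nat.cast_injective h0)
    subst this; subst h2
    exact lt_asymm hr hpq.2.2
  · have : p = q := Fin.ext (Nat.cast_injective h0)
    subst this
    exact lt_irrefl _ hpq.2.2

/-- The variable `x_q` occurs in one factor for each other entry of its column. -/
theorem coeff_spechtPoly_lt_colHeight (T : Tableau τ) {β : Fin N →₀ ℕ}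
    (h : (spechtPoly K T).coeff β ≠ 0) (q : Fin N) : β q < colHeight T (col T q) := by
  classical
  have hA : β q ≤ degreeOf q (spechtPoly K T) := by
    rw [degreeOf_eq_sup]
    exact le_sup (f := fun m : Fin N →₀ ℕ => m q) (mem_support_iff.2 h)
  let P := univ.filter (fun p : Fin N × Fin N => col T p.1 = col T p.2 ∧ row T p.1 < row T p.2)
  have hB : degreeOf q (spechtPoly K T) ≤
      ∑ p ∈ P, if p.1 = q ∨ p.2 = q then 1 else 0 := by
    refine (degreeOf_prod_le q P _).trans (sum_le_sum fun p _ => ?_)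
    refine (degreeOf_sub_le q _ _).trans ?_
    rw [degreeOf_X, degreeOf_X]
    split_ifs with h1 h2 h3 h3 <;> simp_all
  have hC : (∑ p ∈ P, if p.1 = q ∨ p.2 = q then 1 else 0) ≤
      ((univ.filter (fun k => col T k = col T q)).erase q).card := by
    rw [← card_filter]
    refine card_le_card_of_injOn (fun p => if p.1 = q then p.2 else p.1) ?_ ?_
    · rintro ⟨a, b⟩ hp
      simp only [P, coe_filter, mem_filter, mem_univ, true_and, Set.mem_ofPred_eq] at hp
      simp only [coe_erase, coe_filter, mem_univ, true_and, Set.mem_sdiff, Set.mem_ofPred_eq,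
        Set.mem_singleton_iff]
      obtain ⟨⟨h1, h2⟩, h3⟩ := hp
      split_ifs with h4
      · subst h4
        exact ⟨h1.symm, by rintro rfl; exact lt_irrefl _ h2⟩
      · have h3 := h3.resolve_left h4
        subst h3
        exact ⟨h1, h4⟩
    · rintro ⟨a, b⟩ hp ⟨a', b'⟩ hp' e
      simp only [P, coe_filter, mem_filter, mem_univ, true_and, Set.mem_ofPred_eq] at hp hp' e
      obtain ⟨⟨h1, h2⟩, h3⟩ := hp
      obtain ⟨⟨h1', h2'⟩, h3'⟩ := hp'
      split_ifs at e with h4 h5 h5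
      · subst h4 h5 e; rfl
      · have := h3'.resolve_left h5
        subst h4 this e
        exact absurd h2 h2'.not_gt
      · have := h3.resolve_left h4
        subst h5 this e
        exact absurd h2 h2'.not_gt
      · have := h3.resolve_left h4
        have := h3'.resolve_left h5
        subst_vars
        rfl
  have h4 : ((univ.filter (fun k => col T k = col T q)).erase q).card + 1 =
      colHeight T (col T q) := card_erase_add_one (by simp)
  omega

/-- Exchanging two equal exponents in one column fixes the monomial but negates its coefficient. -/
theorem coeff_spechtPoly_injOn [CharZero K] (T : Tableau τ) {β : Fin N →₀ ℕ}
    (h : (spechtPoly K T).coeff β ≠ 0) {a b : Fin N} (hab : col T a = col T b)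
    (hβ : β a = β b) : a = b := by
  by_contra hne
  have h1 := congrArg (coeff β) (permRep_swap_spechtPoly (K := K) T hne hab)
  have h2 : permExp (Equiv.swap a b) β = β := by
    ext p
    rw [permExp_apply]
    rcases eq_or_ne p a with rfl | h1
    · rw [Equiv.swap_apply_left, hβ]
    · rcases eq_or_ne p b with rfl | h2
      · rw [Equiv.swap_apply_right, hβ]
      · rw [Equiv.swap_apply_of_ne_of_ne h1 h2]
  rw [coeff_permRep, h2, coeff_neg] at h1
  exact h (CharZero.eq_neg_self_iff.1 h1)

/-- Pigeonhole: an injection from a column into the numbers below its height is onto. -/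
theorem exists_of_lt_colHeight (T : Tableau τ) {g : Fin N → ℕ}
    (hlt : ∀ k, g k < colHeight T (col T k))
    (hinj : ∀ a b, col T a = col T b → g a = g b → a = b) {c r : ℕ} (hr : r < colHeight T c) :
    ∃ k, col T k = c ∧ g k = r := by
  let B := univ.filter (fun k => col T k = c)
  have h1 : B.image g = range (colHeight T c) := by
    refine eq_of_subset_of_card_le (fun x hx => ?_) ?_
    · obtain ⟨k, hk, rfl⟩ := mem_image.1 hx
      have := hlt k
      rw [(mem_filter.1 hk).2] at this
      exact mem_range.2 this
    · rw [card_range, card_image_of_injOn, colHeight]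
      intro a ha b hb e
      have ha := (mem_filter.1 ha).2
      have hb := (mem_filter.1 hb).2
      exact hinj a b (ha.trans hb.symm) e
  have h2 : r ∈ B.image g := by rw [h1]; exact mem_range.2 hr
  obtain ⟨k, hk, hk'⟩ := mem_image.1 h2
  exact ⟨k, (mem_filter.1 hk).2, hk'⟩

/-- The count depends on the column heights alone. Comparing exponents with row numbers, which
satisfy the same two conditions, shows that exponents have weight `τ`. -/
theorem card_filter_eq_of_columns (T : Tableau τ) {g : Fin N → ℕ}
    (hlt : ∀ k, g k < colHeight T (col T k))
    (hinj : ∀ a b, col T a = col T b → g a = g b → a = b) (r : ℕ) :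
    (univ.filter (fun k => g k = r)).card =
      ((univ.image (col T)).filter (fun c => r < colHeight T c)).card := by
  rw [← card_image_of_injOn (s := univ.filter (fun k => g k = r)) (f := col T)]
  · congr 1
    ext c
    simp only [mem_image, mem_filter, mem_univ, true_and]
    constructor
    · rintro ⟨k, h1, rfl⟩
      exact ⟨⟨k, rfl⟩, h1 ▸ hlt k⟩
    · rintro ⟨-, h⟩
      obtain ⟨k, h1, h2⟩ := exists_of_lt_colHeight T hlt hinj h
      exact ⟨k, h2, h1⟩
  · intro a ha b hb e
    simp only [coe_filter, mem_univ, true_and, Set.mem_ofPred_eq] at ha hb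
    exact hinj a b e (ha.trans hb.symm)

theorem row_lt_colHeight (hτ : Antitone τ) (T : Tableau τ) (k : Fin N) :
    row T k < colHeight T (col T k) := by
  have h : (row T k) + 1 ≤ (univ.filter (fun j => col T j = col T k)).card := by
    have hb : ∀ r, r < row T k + 1 → r < N := fun r hr =>
      lt_of_lt_of_le hr (T k).1.2
    have hb' : ∀ r (hr : r < row T k + 1), col T k < τ ⟨r, hb r hr⟩ := fun r hr =>
      lt_of_lt_of_le (T k).2.2 (hτ (Fin.le_def.2 (Nat.lt_succ_iff.1 hr)))
    refine (card_range (row T k + 1)).symm.le.trans ?_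
    refine card_le_card_of_injOn
      (fun r => if hr : r < row T k + 1 then T.symm ⟨⟨r, hb r hr⟩, ⟨col T k, hb' r hr⟩⟩ else k)
      ?_ ?_
    · intro r hr
      have hr : r < row T k + 1 := by simpa using hr
      refine mem_coe.2 (mem_filter.2 ⟨mem_univ _, ?_⟩)
      beta_reduce
      rw [dif_pos hr]
      unfold col
      rw [Equiv.apply_symm_apply]
    · intro r hr r' hr' e
      have hr : r < row T k + 1 := by simpa using hr
      have hr' : r' < row T k + 1 := by simpa using hr'
      simp only [hr, hr', dif_pos, EmbeddingLike.apply_eq_iff_eq, Sigma.mk.injEq, Fin.mk.injEq] at e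
      exact e.1
  exact h

theorem card_row (T : Tableau τ) (r : Fin N) :
    (univ.filter (fun k => row T k = (r : ℕ))).card = τ r := by
  have h : (univ.filter (fun k => row T k = (r : ℕ))).card =
      (univ.filter (fun x : Σ r : Fin N, Fin (τ r) => x.1 = r)).card := by
    refine card_equiv T fun k => ?_
    simp only [mem_filter, mem_univ, true_and]
    rw [row, Fin.ext_iff]
  rw [h]
  have h2 : univ.filter (fun x : Σ r : Fin N, Fin (τ r) => x.1 = r) =
      univ.map (Function.Embedding.sigmaMk (β := fun r : Fin N => Fin (τ r)) r) := by
    ext ⟨x, y⟩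
    simp only [mem_filter, mem_univ, true_and, mem_map, Function.Embedding.sigmaMk_apply]
    constructor
    · rintro rfl
      exact ⟨y, rfl⟩
    · rintro ⟨z, hz⟩
      exact (congrArg Sigma.fst hz).symm
  rw [h2, card_map, card_univ, Fintype.card_fin]

theorem hasWeight_spechtPoly [CharZero K] (hτ : Antitone τ) (T : Tableau τ) :
    HasWeight τ (spechtPoly K T) := by
  intro β hβ r
  rw [card_filter_eq_of_columns T (coeff_spechtPoly_lt_colHeight T hβ)
    (fun a b => coeff_spechtPoly_injOn T hβ), ← card_row T r,
    card_filter_eq_of_columns T (row_lt_colHeight hτ T)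
    (fun a b h1 h2 => tableau_ext T h2 h1)]

/-- A sign-reversing involution. In a nonzero term the column of `q` contains the exponent `m`,
hence also the smaller exponent `j` at some other `q'`; moving the `m` to `q'` is a transposition
within the column. -/
theorem isHighestWeight_spechtPoly [CharZero K] (T : Tableau τ) :
    IsHighestWeight (spechtPoly K T) := by
  intro j m hjm β
  set f := spechtPoly K T with hf
  have hex : ∀ q, β q = j → f.coeff (β.update q m) ≠ 0 →
      ∃ q', q' ≠ q ∧ col T q' = col T q ∧ β q' = j := by
    intro q hq h0
    have hm := coeff_spechtPoly_lt_colHeight T h0 q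
    simp only [Finsupp.coe_update, Function.update_self] at hm
    obtain ⟨q', h1, h2⟩ := exists_of_lt_colHeight T (coeff_spechtPoly_lt_colHeight T h0)
      (fun a b => coeff_spechtPoly_injOn T h0) (hjm.trans hm)
    have hne : q' ≠ q := by
      rintro rfl
      simp at h2
      omega
    exact ⟨q', hne, h1, by simpa [hne] using h2⟩
  have hneg : ∀ q q', q' ≠ q → col T q' = col T q → β q = j → β q' = j →
      f.coeff (β.update q' m) = - f.coeff (β.update q m) := by
    intro q q' hne hc hq hq'
    rw [← coeff_neg, ← permRep_swap_spechtPoly T hne hc, coeff_permRep]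
    congr 1
    ext s
    rw [permExp_apply]
    rcases eq_or_ne s q' with rfl | h1
    · simp
    · rcases eq_or_ne s q with rfl | h2
      · simp [hne, hne.symm, hq, hq']
      · rw [Equiv.swap_apply_of_ne_of_ne h1 h2]
        simp [h1, h2]
  have huniq : ∀ q q' q'', f.coeff (β.update q m) ≠ 0 → β q' = j → β q'' = j → q' ≠ q → q'' ≠ q →
      col T q' = col T q'' → q' = q'' := by
    intro q q' q'' h0 h1 h2 h3 h4 h5
    refine coeff_spechtPoly_injOn T h0 h5 ?_
    simp [h3, h4, h1, h2]
  classical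
  let σ : Fin N → Fin N := fun q =>
    if h : β q = j ∧ f.coeff (β.update q m) ≠ 0 then (hex q h.1 h.2).choose else q
  have hσ : ∀ q, β q = j → f.coeff (β.update q m) ≠ 0 →
      σ q ≠ q ∧ col T (σ q) = col T q ∧ β (σ q) = j := by
    intro q h1 h2
    simp only [σ]
    rw [dif_pos ⟨h1, h2⟩]
    exact (hex q h1 h2).choose_spec
  have hσ0 : ∀ q, f.coeff (β.update q m) = 0 → σ q = q := by
    intro q h
    simp only [σ]
    rw [dif_neg fun h' => h'.2 h]
  refine sum_involution (fun q _ => σ q) ?_ ?_ ?_ ?_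
  · intro q hq
    have hq := (mem_filter.1 hq).2
    by_cases h0 : f.coeff (β.update q m) = 0
    · rw [hσ0 q h0, h0, add_zero]
    · obtain ⟨h1, h2, h3⟩ := hσ q hq h0
      rw [hneg q (σ q) h1 h2 hq h3, add_neg_cancel]
  · intro q hq h0
    exact (hσ q (mem_filter.1 hq).2 h0).1
  · intro q hq
    have hq := (mem_filter.1 hq).2
    by_cases h0 : f.coeff (β.update q m) = 0
    · rw [hσ0 q h0]; simpa using hq
    · simpa using (hσ q hq h0).2.2
  · intro q hq
    have hq := (mem_filter.1 hq).2
    by_cases h0 : f.coeff (β.update q m) = 0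
    · rw [hσ0 q h0, hσ0 q h0]
    · obtain ⟨h1, h2, h3⟩ := hσ q hq h0
      have h0' : f.coeff (β.update (σ q) m) ≠ 0 := by
        rw [hneg q (σ q) h1 h2 hq h3]
        exact neg_ne_zero.2 h0
      obtain ⟨h1', h2', h3'⟩ := hσ (σ q) h3 h0'
      exact huniq (σ q) _ _ h0' h3' hq h1' h1.symm (h2'.trans h2)

theorem isHighestWeight_of_mem [CharZero K] {f : MvPolynomial (Fin N) K}
    (hf : f ∈ spechtModule K τ) : IsHighestWeight f := by
  change f ∈ Submodule.span K (Set.range fun T : Tableau τ => spechtPoly K T) at hf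
  induction hf using Submodule.span_induction with
  | mem x hx =>
    obtain ⟨T, rfl⟩ := hx
    exact isHighestWeight_spechtPoly T
  | zero => intro j m _ β; simp
  | add x y _ _ hx hy =>
    intro j m h β
    simp only [coeff_add, sum_add_distrib, hx j m h β, hy j m h β, add_zero]
  | smul a x _ hx =>
    intro j m h β
    simp only [coeff_smul, ← smul_sum, hx j m h β, smul_zero]

theorem hasWeight_of_mem [CharZero K] (hτ : Antitone τ) {f : MvPolynomial (Fin N) K}
    (hf : f ∈ spechtModule K τ) : HasWeight τ f := by
  change f ∈ Submodule.span K (Set.range fun T : Tableau τ => spechtPoly K T) at hf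
  induction hf using Submodule.span_induction with
  | mem x hx =>
    obtain ⟨T, rfl⟩ := hx
    exact hasWeight_spechtPoly hτ T
  | zero => intro β h; simp at h
  | add x y _ _ hx hy =>
    intro β h
    by_cases h1 : x.coeff β = 0
    · exact hy β fun h2 => h (by rw [coeff_add, h1, h2, add_zero])
    · exact hx β h1
  | smul a x _ hx =>
    intro β h
    exact hx β fun h2 => h (by rw [coeff_smul, h2, smul_zero])

end Specht

/-! ### Lattice words are separated by their contents -/

section Lattice

variable {N : ℕ}

theorem IsLattice.card_lt_antitone {α : Fin N → ℕ} (hα : IsLattice α) (p : Fin N) :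
    Antitone fun r => (univ.filter (fun q => p < q ∧ α q = r)).card := by
  refine antitone_nat_of_succ_le fun r => ?_
  by_cases hp : (p : ℕ) + 1 < N
  · have h := hα ⟨p + 1, hp⟩ r
    have e : ∀ q : Fin N, (⟨p + 1, hp⟩ : Fin N) ≤ q ↔ p < q := fun q => Iff.rfl
    simpa only [e] using h
  · have : univ.filter (fun q => p < q ∧ α q = r + 1) = ∅ := by
      refine filter_eq_empty_iff.2 ?_
      rintro q - ⟨h, -⟩
      have := q.2
      omega
    rw [this, card_empty]
    exact Nat.zero_le _

/-- Lattice words are determined by their contents. -/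
theorem eq_of_expContent_eq {α β : Fin N → ℕ} (hβ : IsLattice β)
    (h : ∀ p, expContent α p = expContent β p) : α = β := by
  funext p
  induction p using WellFoundedGT.induction with
  | ind p ih =>
    have e : ∀ r, univ.filter (fun q => p < q ∧ α q = r) = univ.filter (fun q => p < q ∧ β q = r) :=
      fun r => filter_congr fun q _ => and_congr_right fun hq => by rw [ih q hq]
    have hp := h p
    rw [expContent, expContent, e] at hp
    -- Beyond `p` the words agree. The multiplicity of `r` there is nonincreasing in `r`, so that
    -- multiplicity minus `r` is strictly decreasing and determines the letter.
    rcases lt_trichotomy (α p) (β p) with h1 | h1 | h1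
    · have := hβ.card_lt_antitone p h1.le
      simp only at this
      omega
    · exact h1
    · have := hβ.card_lt_antitone p h1.le
      simp only at this
      omega

/-- The letters below `N` already fill `∑ τ = N` positions. -/
theorem lt_of_card_eq {τ : Fin N → ℕ} (hτ : IsPartition τ) {α : Fin N → ℕ}
    (h : ∀ r : Fin N, (univ.filter (fun q => α q = (r : ℕ))).card = τ r) (q : Fin N) :
    α q < N := by
  have h1 : (univ.filter (fun q => α q < N)).card = N := by
    rw [card_eq_sum_card_fiberwise (f := α) (t := range N)
      (fun q hq => by simpa using hq)]
    refine Eq.trans ?_ hτ.2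
    rw [sum_range]
    refine sum_congr rfl fun r _ => ?_
    rw [← h r, filter_filter]
    congr 1
    refine filter_congr fun q _ => ?_
    constructor
    · exact fun h => h.2
    · exact fun h => ⟨h ▸ r.2, h⟩
  have h2 : univ.filter (fun q => α q < N) = univ :=
    eq_univ_of_card _ (by rw [h1, Fintype.card_fin])
  have h3 : q ∈ univ.filter (fun q => α q < N) := by rw [h2]; exact mem_univ _
  exact (mem_filter.1 h3).2

end Lattice

/-! ### Joint spectrum of the Murphy elements on the Specht module -/

section Spectrum

variable {K : Type*} [Field K] {N : ℕ} {τ : Fin N → ℕ}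

/-- The Murphy element `∑_{q > p} (p q)` as a linear map. -/
noncomputable def murphyMap (K : Type*) [Field K] (p : Fin N) :
    MvPolynomial (Fin N) K →ₗ[K] MvPolynomial (Fin N) K :=
  ∑ q ∈ univ.filter (fun q => p < q), permRep K N (Equiv.swap p q)

theorem murphyMap_apply (p : Fin N) (f : MvPolynomial (Fin N) K) :
    murphyMap K p f = murphy p.rev f := by
  rw [murphy_rev, murphyMap, LinearMap.sum_apply]

/-- Such a `w` permutes the positions after `p`, so conjugation by it permutes the transpositions in
the sum. -/
theorem murphyMap_permRep {p : Fin N} {w : Equiv.Perm (Fin N)} (hw : ∀ s ≤ p, w s = s)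
    (f : MvPolynomial (Fin N) K) :
    murphyMap K p (permRep K N w f) = permRep K N w (murphyMap K p f) := by
  have hlt : ∀ s, p < s ↔ p < w s := by
    intro s
    constructor
    · intro h
      by_contra h'
      have := hw (w s) (not_lt.1 h')
      exact h' (by rwa [w.injective this])
    · intro h
      by_contra h'
      rw [hw s (not_lt.1 h')] at h
      exact h' h
  rw [murphyMap, LinearMap.sum_apply, LinearMap.sum_apply, map_sum]
  symm
  refine sum_equiv w (fun q => by simpa using hlt q) fun q _ => ?_
  conv_rhs => rw [← hw p le_rfl]
  rw [hw p le_rfl, ← permRep_swap_permRep, hw p le_rfl]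

/-- For `p < q` every transposition in the element at `q` fixes all positions up to `p`, so it
commutes with the element at `p`. -/
theorem murphyMap_comm (p q : Fin N) (f : MvPolynomial (Fin N) K) :
    murphyMap K p (murphyMap K q f) = murphyMap K q (murphyMap K p f) := by
  wlog h : p < q generalizing p q
  · rcases eq_or_ne p q with rfl | hne
    · rfl
    · exact (this q p (by omega)).symm
  conv_lhs => rw [murphyMap.eq_def K q, LinearMap.sum_apply, map_sum]
  conv_rhs => rw [murphyMap.eq_def K q, LinearMap.sum_apply]
  refine sum_congr rfl fun r hr => murphyMap_permRep (fun s hs => ?_) f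
  have := (mem_filter.1 hr).2
  exact Equiv.swap_apply_of_ne_of_ne (by omega) (by omega)

theorem murphyMap_mem {M : Subrepresentation (permRep K N)} (p : Fin N)
    {f : MvPolynomial (Fin N) K} (hf : f ∈ M) : murphyMap K p f ∈ M := by
  rw [murphyMap, LinearMap.sum_apply]
  exact M.toSubmodule.sum_mem fun q _ => M.apply_mem_toSubmodule _ hf

/-- `f` is a joint eigenvector of the Murphy elements, with the contents of `α` as eigenvalues. -/
def IsContentVector (α : Fin N → ℕ) (f : MvPolynomial (Fin N) K) : Prop :=
  ∀ p, murphyMap K p f = (expContent α p : K) • f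

theorem exists_lead {f : MvPolynomial (Fin N) K} (hf : f ≠ 0) :
    ∃ α, f.coeff α ≠ 0 ∧ LexBounded f α := by
  obtain ⟨α, h1, h2⟩ := exists_max_image f.support (fun β => toLex β) (support_nonempty.2 hf)
  exact ⟨α, mem_support_iff.1 h1, fun β hβ => h2 β (mem_support_iff.2 hβ)⟩

theorem LexBounded.sub_smul {f g : MvPolynomial (Fin N) K} {α : Fin N →₀ ℕ}
    (hf : LexBounded f α) (hg : LexBounded g α) (c : K) : LexBounded (f - c • g) α := by
  intro β hβ
  by_cases h : f.coeff β = 0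
  · refine hg β fun h' => hβ ?_
    rw [coeff_sub, coeff_smul, h, h', smul_zero, sub_zero]
  · exact hf β h

theorem IsContentVector.sub_smul {f g : MvPolynomial (Fin N) K} {α : Fin N → ℕ}
    (hf : IsContentVector α f) (hg : IsContentVector α g) (c : K) :
    IsContentVector α (f - c • g) := by
  intro p
  rw [map_sub, map_smul, hf p, hg p, smul_sub, smul_comm]

variable [CharZero K]

theorem coeff_murphyMap_of_le {f : MvPolynomial (Fin N) K} (hf : f ∈ spechtModule K τ)
    {α β : Fin N →₀ ℕ} (hb : LexBounded f α) (hle : toLex α ≤ toLex β) (p : Fin N) :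
    (murphyMap K p f).coeff β = (expContent α p : K) * f.coeff β := by
  rw [murphyMap_apply]
  exact coeff_murphy_of_le (isHighestWeight_of_mem hf) hb hle p

theorem LexBounded.murphyMap {f : MvPolynomial (Fin N) K} (hf : f ∈ spechtModule K τ)
    {α : Fin N →₀ ℕ} (hb : LexBounded f α) (p : Fin N) : LexBounded (murphyMap K p f) α := by
  intro β hβ
  by_contra hlt
  rw [not_le] at hlt
  rw [coeff_murphyMap_of_le hf hb hlt.le] at hβ
  exact not_lt_of_ge (hb β (right_ne_zero_of_mul hβ)) hlt

/-- An operator that fixes leading terms at `α` and annihilates given content vectors. -/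
theorem exists_projector (τ : Fin N → ℕ) (α : Fin N →₀ ℕ)
    (B : Finset (Fin N →₀ ℕ)) (hB : ∀ β ∈ B, IsLattice β ∧ β ≠ α) :
    ∃ A : MvPolynomial (Fin N) K →ₗ[K] MvPolynomial (Fin N) K,
      (∀ p f, A (murphyMap K p f) = murphyMap K p (A f)) ∧
      (∀ f ∈ spechtModule K τ, LexBounded f α →
        A f ∈ spechtModule K τ ∧ LexBounded (A f) α ∧ (A f).coeff α = f.coeff α) ∧
      ∀ β ∈ B, ∀ f, IsContentVector β f → A f = 0 := by
  induction B using Finset.induction_on with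
  | empty =>
    exact ⟨LinearMap.id, fun _ _ => rfl, fun f hf hb => ⟨hf, hb, rfl⟩, fun β hβ => by simp at hβ⟩
  | insert β B _ ih =>
    obtain ⟨A, h1, h2, h3⟩ := ih fun β hβ => hB β (mem_insert_of_mem hβ)
    obtain ⟨hβ, hne⟩ := hB β (mem_insert_self _ _)
    obtain ⟨p, hp⟩ : ∃ p, expContent α p ≠ expContent β p := by
      by_contra h
      push Not at h
      exact hne (DFunLike.coe_injective (eq_of_expContent_eq hβ h)).symm
    have hc : (expContent α p : K) - (expContent β p : K) ≠ 0 :=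
      sub_ne_zero.2 fun h => hp (Int.cast_injective h)
    let c := (expContent α p : K) - (expContent β p : K)
    -- A Lagrange factor: it vanishes on the contents of `β` and has diagonal entry `1` at `α`.
    refine ⟨c⁻¹ • (murphyMap K p - (expContent β p : K) • LinearMap.id) ∘ₗ A, ?_, ?_, ?_⟩
    · intro q f
      simp [h1, murphyMap_comm p q]
    · intro f hf hb
      obtain ⟨a1, a2, a3⟩ := h2 f hf hb
      refine ⟨?_, ?_, ?_⟩
      · exact (spechtModule K τ).toSubmodule.smul_mem _
          ((spechtModule K τ).toSubmodule.sub_mem (murphyMap_mem p a1)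
            ((spechtModule K τ).toSubmodule.smul_mem _ a1))
      · intro γ hγ
        refine (a2.murphyMap a1 p).sub_smul a2 (expContent β p : K) γ fun h => hγ ?_
        simp only [LinearMap.smul_apply, LinearMap.comp_apply, LinearMap.sub_apply,
          LinearMap.id_apply, coeff_smul]
        rw [h, smul_zero]
      · simp only [LinearMap.smul_apply, LinearMap.comp_apply, LinearMap.sub_apply,
          LinearMap.id_apply, coeff_smul, coeff_sub, coeff_murphyMap_of_le a1 a2 le_rfl, a3,
          smul_eq_mul]
        rw [← sub_mul, inv_mul_cancel_left₀ hc]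
    · intro γ hγ f hf
      simp only [LinearMap.smul_apply, LinearMap.comp_apply, LinearMap.sub_apply,
          LinearMap.id_apply]
      rcases mem_insert.1 hγ with rfl | hγ
      · rw [← h1, hf p, map_smul, sub_self, smul_zero]
      · rw [h3 γ hγ f hf, map_zero, smul_zero, sub_zero, smul_zero]

/-- The lattice words of weight `τ`. -/
def IsLatticeWord (τ α : Fin N → ℕ) : Prop :=
  IsLattice α ∧ ∀ r : Fin N, (univ.filter (fun q => α q = (r : ℕ))).card = τ r

theorem isLatticeWord_of_lead (hτ : IsPartition τ) {f : MvPolynomial (Fin N) K}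
    (hf : f ∈ spechtModule K τ) {α : Fin N →₀ ℕ} (h0 : f.coeff α ≠ 0) (hb : LexBounded f α) :
    IsLatticeWord τ α :=
  ⟨isLattice_of_isHighestWeight (isHighestWeight_of_mem hf) hb h0, hasWeight_of_mem hτ.1 hf α h0⟩

/-- The Specht module is spanned by joint eigenvectors of the Murphy elements, whose eigenvalues
are the contents of lattice words. -/
theorem mem_span_contentVectors (hτ : IsPartition τ) {f : MvPolynomial (Fin N) K}
    (hf : f ∈ spechtModule K τ) :
    f ∈ Submodule.span K {v | v ∈ spechtModule K τ ∧
      ∃ α : Fin N →₀ ℕ, IsLatticeWord τ α ∧ IsContentVector α v} := by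
  let S := spechtModule K τ
  let W : (Fin N →₀ ℕ) → Submodule K (MvPolynomial (Fin N) K) := fun γ =>
    Submodule.span K {v | v ∈ spechtModule K τ ∧
      ∃ α : Fin N →₀ ℕ, toLex α ≤ toLex γ ∧ IsLatticeWord τ α ∧ IsContentVector α v}
  have hfin : {α : Fin N →₀ ℕ | IsLatticeWord τ α}.Finite := by
    refine Set.Finite.of_injOn (f := fun β : Fin N →₀ ℕ => (β : Fin N → ℕ))
      (t := Set.Iic fun _ => N) ?_ (DFunLike.coe_injective.injOn) (Set.finite_Iic _)
    intro β hβ i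
    exact (lt_of_card_eq hτ hβ.2 i).le
  have hmono : ∀ {γ γ'}, toLex γ ≤ toLex γ' → W γ ≤ W γ' := fun h =>
    Submodule.span_mono fun v ⟨h1, α, h2, h3⟩ => ⟨h1, α, h2.trans h, h3⟩
  have key : ∀ a : Lex (Fin N →₀ ℕ), ∀ g ∈ S, g.coeff (ofLex a) ≠ 0 → LexBounded g (ofLex a) →
      g ∈ W (ofLex a) := by
    intro a
    have : WellFoundedLT (Lex (Fin N →₀ ℕ)) := Finsupp.Lex.wellFoundedLT_of_finite
    induction a using WellFoundedLT.induction with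
    | ind a ih =>
      intro g hg h0 hb
      set α := ofLex a with hα
      have hlat := isLatticeWord_of_lead hτ hg h0 hb
      obtain ⟨A, h1, h2, h3⟩ := exists_projector (K := K) τ α
        (hfin.toFinset.filter fun β => toLex β < toLex α) (fun β hβ => by
          simp only [mem_filter, Set.Finite.mem_toFinset, Set.mem_ofPred_eq] at hβ
          exact ⟨hβ.1.1, by rintro rfl; exact lt_irrefl _ hβ.2⟩)
      -- Vectors with strictly smaller leading word are, by induction, combinations of content
      -- vectors for smaller lattice words, all of which `A` kills.
      have hlow : ∀ u ∈ S, LexBounded u α → u.coeff α = 0 → A u = 0 ∧ u ∈ W α := by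
        intro u hu hub hu0
        rcases eq_or_ne u 0 with rfl | hne
        · exact ⟨map_zero _, Submodule.zero_mem _⟩
        · obtain ⟨β, hβ, hβb⟩ := exists_lead hne
          have hlt : toLex β < toLex α := lt_of_le_of_ne (hub β hβ) fun e => by
            rw [toLex.injective e] at hβ
            exact hβ hu0
          have hW := ih (toLex β) hlt u hu hβ hβb
          refine ⟨?_, hmono hlt.le hW⟩
          have hle : W β ≤ LinearMap.ker A := by
            refine Submodule.span_le.2 ?_
            rintro v ⟨-, δ, hδ, hδ', hv⟩
            refine h3 δ ?_ v hv
            simp only [mem_filter, Set.Finite.mem_toFinset, Set.mem_ofPred_eq]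
            exact ⟨hδ', hδ.trans_lt hlt⟩
          exact hle hW
      obtain ⟨a1, a2, a3⟩ := h2 g hg hb
      have hAg : A g ∈ W α := by
        refine Submodule.subset_span ⟨a1, α, le_rfl, hlat, fun p => ?_⟩
        -- The difference between the Murphy image and the expected multiple of `g` has smaller
        -- leading word, so `A` kills it. As `A` commutes with the Murphy elements, `A g` is an
        -- eigenvector.
        have h4 := (hlow (murphyMap K p g - (expContent α p : K) • g)
          (S.toSubmodule.sub_mem (murphyMap_mem p hg) (S.toSubmodule.smul_mem _ hg))
          ((hb.murphyMap hg p).sub_smul hb _)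
          (by rw [coeff_sub, coeff_smul, coeff_murphyMap_of_le hg hb le_rfl, smul_eq_mul,
                sub_self])).1
        rwa [map_sub, h1, map_smul, sub_eq_zero] at h4
      have h5 := (hlow (g - (1 : K) • A g)
        (S.toSubmodule.sub_mem hg (S.toSubmodule.smul_mem _ a1)) (hb.sub_smul a2 1)
        (by rw [coeff_sub, coeff_smul, a3, one_smul, sub_self])).2
      rw [one_smul] at h5
      have := Submodule.add_mem _ h5 hAg
      rwa [sub_add_cancel] at this
  rcases eq_or_ne f 0 with rfl | hne
  · exact Submodule.zero_mem _
  · obtain ⟨α, h0, hb⟩ := exists_lead hne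
    refine Submodule.span_mono ?_ (key (toLex α) f hf h0 hb)
    rintro v ⟨h1, β, -, h2⟩
    exact ⟨h1, β, h2⟩

/-- By triangularity the eigenvalues are also the contents of the lexicographic leading word, which
is a lattice word and therefore equals `α`. -/
theorem IsContentVector.coeff_ne_zero (hτ : IsPartition τ) {f : MvPolynomial (Fin N) K}
    (hf : f ∈ spechtModule K τ) {α : Fin N →₀ ℕ} (h : IsContentVector α f)
    (hne : f ≠ 0) : f.coeff α ≠ 0 := by
  obtain ⟨β, h0, hb⟩ := exists_lead hne
  have hβ := isLatticeWord_of_lead hτ hf h0 hb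
  have : α = β := DFunLike.coe_injective (eq_of_expContent_eq hβ.1 fun p => by
    have h1 := coeff_murphyMap_of_le hf hb le_rfl p
    rw [h p, coeff_smul, smul_eq_mul] at h1
    exact Int.cast_injective (mul_right_cancel₀ h0 h1))
  rwa [← this] at h0

/-- Joint eigenspaces of the Murphy elements on a Specht module have dimension at most one. -/
theorem IsContentVector.eq_smul (hτ : IsPartition τ) {f v : MvPolynomial (Fin N) K}
    (hf : f ∈ spechtModule K τ) (hv : v ∈ spechtModule K τ) {α : Fin N →₀ ℕ}
    (hfα : IsContentVector α f) (hvα : IsContentVector α v) (hv0 : v ≠ 0) :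
    f = (f.coeff α / v.coeff α) • v := by
  by_contra h
  have hmem : f - (f.coeff α / v.coeff α) • v ∈ spechtModule K τ :=
    (spechtModule K τ).toSubmodule.sub_mem hf ((spechtModule K τ).toSubmodule.smul_mem _ hv)
  refine (hfα.sub_smul hvα _).coeff_ne_zero hτ hmem (sub_ne_zero.2 h) ?_
  rw [coeff_sub, coeff_smul, smul_eq_mul, div_mul_cancel₀ _ (hvα.coeff_ne_zero hτ hv hv0),
    sub_self]

end Spectrum

/-! ### Row reading words and the eigenvalue equations -/

section RowWords

variable {N : ℕ} {τ : Fin N → ℕ}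

/-- `∑_{j < s} τ_j`, the number of nodes above the row `s`. -/
def nodesAbove (τ : Fin N → ℕ) (s : ℕ) : ℕ := ∑ j ∈ univ.filter (fun j : Fin N => (j : ℕ) < s), τ j

/-- `∑_{j < s} (τ_j + 1)`. -/
def rowShift (τ : Fin N → ℕ) (s : ℕ) : ℕ :=
  ∑ j ∈ univ.filter (fun j : Fin N => (j : ℕ) < s), (τ j + 1)

theorem rowShift_eq {s : ℕ} (hs : s < N) : rowShift τ s = nodesAbove τ s + s := by
  rw [rowShift, sum_add_distrib, nodesAbove, sum_const, smul_eq_mul, mul_one]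
  congr 1
  have : univ.filter (fun j : Fin N => (j : ℕ) < s) = Iio ⟨s, hs⟩ := by
    ext j; simp [Fin.lt_def]
  rw [this, Fin.card_Iio]

theorem sum_filter_lt_succ {M : Type*} [AddCommMonoid M] (g : Fin N → M) (s : Fin N) :
    ∑ j ∈ univ.filter (fun j : Fin N => (j : ℕ) < s + 1), g j =
      ∑ j ∈ univ.filter (fun j : Fin N => (j : ℕ) < s), g j + g s := by
  have : univ.filter (fun j : Fin N => (j : ℕ) < s + 1) =
      insert s (univ.filter (fun j : Fin N => (j : ℕ) < s)) := by
    ext j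
    simp only [mem_filter, mem_univ, true_and, mem_insert, Fin.ext_iff]
    omega
  rw [this, sum_insert (by simp), add_comm]

theorem nodesAbove_mono {s t : ℕ} (h : s ≤ t) : nodesAbove τ s ≤ nodesAbove τ t :=
  sum_le_sum_of_subset fun j hj => by simp at hj ⊢; omega

theorem card_filter_lt {α : Fin N → ℕ}
    (h : ∀ r : Fin N, (univ.filter (fun q => α q = (r : ℕ))).card = τ r) (s : ℕ) (hs : s ≤ N) :
    (univ.filter (fun q => α q < s)).card = nodesAbove τ s := by
  rw [card_eq_sum_card_fiberwise (f := α)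
    (t := (univ.filter (fun j : Fin N => (j : ℕ) < s)).map Fin.valEmbedding), sum_map, nodesAbove]
  · refine sum_congr rfl fun r hr => ?_
    have hr := (mem_filter.1 hr).2
    rw [← h r, filter_filter]
    congr 1
    refine filter_congr fun q _ => ?_
    simp only [Fin.valEmbedding_apply]
    constructor
    · exact fun h => h.2
    · exact fun h => ⟨h ▸ hr, h⟩
  · intro q hq
    have hq : α q < s := by simpa using hq
    simp only [coe_map, Set.mem_image, Fin.valEmbedding_apply]
    exact ⟨⟨α q, by omega⟩, by simpa using hq, rfl⟩

theorem card_filter_gt (p : Fin N) : (univ.filter (fun q => p < q)).card = N - 1 - p := by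
  have : univ.filter (fun q => p < q) = Ioi p := by ext; simp
  rw [this, Fin.card_Ioi]

/-- In a nonincreasing word, the position `p` lies in the block of its row. -/
theorem nodesAbove_le_of_antitone (hτ : IsPartition τ) {α : Fin N → ℕ} (hα : Antitone α)
    (h : ∀ r : Fin N, (univ.filter (fun q => α q = (r : ℕ))).card = τ r) (p : Fin N) :
    nodesAbove τ (α p) ≤ p.rev ∧ (p.rev : ℕ) < nodesAbove τ (α p + 1) := by
  have hlt := lt_of_card_eq hτ h p
  have hp : (p.rev : ℕ) = N - 1 - p := by rw [Fin.val_rev]; omega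
  rw [← card_filter_lt h _ hlt.le, ← card_filter_lt h _ (Nat.succ_le_of_lt hlt), hp,
    ← card_filter_gt p]
  constructor
  · refine card_le_card fun q hq => ?_
    simp only [mem_filter, mem_univ, true_and] at hq ⊢
    by_contra hle
    exact absurd (hα (not_lt.1 hle)) (by omega)
  · refine card_lt_card ⟨fun q hq => ?_, fun hsub => ?_⟩
    · simp only [mem_filter, mem_univ, true_and] at hq ⊢
      have := hα hq.le
      omega
    · have : p ∈ univ.filter (fun q => p < q) := hsub (by simp)
      simp at this

theorem row_unique {s t i : ℕ} (h1 : nodesAbove τ s ≤ i) (h2 : i < nodesAbove τ (s + 1))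
    (h3 : nodesAbove τ t ≤ i) (h4 : i < nodesAbove τ (t + 1)) : s = t := by
  rcases lt_trichotomy s t with h | h | h
  · have := nodesAbove_mono (τ := τ) (show s + 1 ≤ t from h)
    omega
  · exact h
  · have := nodesAbove_mono (τ := τ) (show t + 1 ≤ s from h)
    omega

theorem antitone_word_unique (hτ : IsPartition τ) {α β : Fin N → ℕ} (hα : Antitone α)
    (hβ : Antitone β) (h : ∀ r : Fin N, (univ.filter (fun q => α q = (r : ℕ))).card = τ r)
    (h' : ∀ r : Fin N, (univ.filter (fun q => β q = (r : ℕ))).card = τ r) : α = β := by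
  funext p
  obtain ⟨h1, h2⟩ := nodesAbove_le_of_antitone hτ hα h p
  obtain ⟨h3, h4⟩ := nodesAbove_le_of_antitone hτ hβ h' p
  exact row_unique h1 h2 h3 h4

/-- In a nonincreasing word the positions after `p` carry either the same letter or a smaller one,
and all smaller letters lie there. So the left side counts the nodes above the row and adds the row
index. -/
theorem sub_expContent_of_antitone (hτ : IsPartition τ) {α : Fin N → ℕ} (hα : Antitone α)
    (h : ∀ r : Fin N, (univ.filter (fun q => α q = (r : ℕ))).card = τ r) (p : Fin N) :
    ((N : ℤ) - 1 - p) - expContent α p = rowShift τ (α p) := by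
  have hlt := lt_of_card_eq hτ h p
  rw [rowShift_eq hlt, ← card_filter_lt h _ hlt.le, expContent]
  have h1 : (univ.filter (fun q => p < q ∧ α q = α p)).card + (univ.filter (fun q => α q < α p)).card
      = (univ.filter (fun q => p < q)).card := by
    rw [← card_union_of_disjoint]
    · congr 1
      ext q
      simp only [mem_union, mem_filter, mem_univ, true_and]
      constructor
      · rintro (h1 | h1)
        · exact h1.1
        · by_contra hle
          exact absurd (hα (not_lt.1 hle)) (by omega)
      · intro h1
        have := hα h1.le
        omega
    · rw [disjoint_filter]
      rintro q - h1 h2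
      omega
  rw [card_filter_gt] at h1
  have := p.2
  push_cast
  omega

theorem rank_of_antitone {γ : Fin N → ℕ} (hγ : Antitone γ) (p : Fin N) :
    rank γ p = p + 1 := by
  rw [rank, ← card_union_of_disjoint]
  · have : univ.filter (fun j => γ p < γ j) ∪ univ.filter (fun j => j ≤ p ∧ γ j = γ p) = Iic p := by
      ext q
      simp only [mem_union, mem_filter, mem_univ, true_and, mem_Iic]
      constructor
      · rintro (h1 | h1)
        · by_contra hle
          exact absurd (hγ (not_le.1 hle).le) (by omega)
        · exact h1.1
      · intro h1
        have := hγ h1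
        omega
    rw [this, Fin.card_Iic]
  · rw [disjoint_filter]
    rintro q - h1 h2
    omega

variable {K : Type*} [Field K] [CharZero K]

/-- The eigenvalue equations, cleared of denominators. -/
theorem xi_eq_iff {m n : ℕ} (hn : 0 < n) {κ₀ : ℚ} (hκ : κ₀ = -(m : ℚ) / n) {γ : Fin N → ℕ}
    (hγ : Antitone γ) (p : Fin N) (c : ℤ) :
    xi (κ₀ : K) γ p = 1 + (κ₀ : K) * (c : K) ↔
      (n : ℤ) * γ p = m * (((N : ℤ) - 1 - p) - c) := by
  have hn0 : (n : ℚ) ≠ 0 := by exact_mod_cast hn.ne'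
  have h1 : xi (κ₀ : K) γ p = 1 + (κ₀ : K) * (c : K) ↔
      ((N : ℚ) - (p + 1 : ℕ)) * κ₀ + (γ p : ℚ) + 1 = 1 + κ₀ * (c : ℚ) := by
    rw [xi, rank_of_antitone hγ, ← Rat.cast_inj (α := K)]
    push_cast
    rfl
  rw [h1, hκ, ← Int.cast_inj (α := ℚ)]
  push_cast
  constructor
  · intro h
    field_simp at h
    linarith
  · intro h
    field_simp
    linarith

/-- Monotonicity of `γ` allows the content at `p` to exceed that at `p + 1` by at most `1`. At an
ascent of a lattice word the smaller letter is at least as frequent after `p` as the larger one,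
which makes the excess at least `2`. -/
theorem antitone_of_eigenvalues {m n : ℕ} (hm : 0 < m) {α γ : Fin N → ℕ} (hα : IsLattice α)
    (hγ : Antitone γ)
    (h : ∀ p : Fin N, (n : ℤ) * γ p = m * (((N : ℤ) - 1 - p) - expContent α p)) :
    Antitone α := by
  have step : ∀ p p' : Fin N, (p' : ℕ) = p + 1 → α p' ≤ α p := by
    intro p p' hp
    by_contra hlt
    rw [not_le] at hlt
    have h1 : (n : ℤ) * γ p' ≤ n * γ p := by
      have := hγ (show p ≤ p' from Fin.le_def.2 (by omega))
      gcongr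
    rw [h p, h p'] at h1
    have h2 := le_of_mul_le_mul_left h1 (by exact_mod_cast hm)
    have h3 := hα.card_lt_antitone p hlt.le
    simp only at h3
    have h4 : univ.filter (fun q => p < q ∧ α q = α p') =
        insert p' (univ.filter (fun q => p' < q ∧ α q = α p')) := by
      ext q
      simp only [mem_filter, mem_univ, true_and, mem_insert]
      constructor
      · rintro ⟨h5, h6⟩
        rcases eq_or_ne q p' with e | e
        · exact Or.inl e
        · exact Or.inr ⟨by omega, h6⟩
      · rintro (rfl | ⟨h5, h6⟩)
        · exact ⟨by omega, rfl⟩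
        · exact ⟨by omega, h6⟩
    rw [h4, card_insert_of_notMem (by simp)] at h3
    rw [expContent, expContent] at h2
    omega
  have key : ∀ k : ℕ, ∀ p p' : Fin N, (p' : ℕ) = p + k → α p' ≤ α p := by
    intro k
    induction k with
    | zero =>
      intro p p' h
      rw [Fin.ext (show (p' : ℕ) = p from h)]
    | succ k ih =>
      intro p p' h
      have h1 : (p : ℕ) + k < N := by have := p'.2; omega
      exact (step ⟨p + k, h1⟩ p' (by simp; omega)).trans (ih p ⟨p + k, h1⟩ rfl)
  intro p p' h
  exact key (p' - p) p p' (by have := Fin.le_def.1 h; omega)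

theorem isLambda_of_rowShift {m n : ℕ} (hn : 0 < n) {κ₀ : ℚ} (hκ : κ₀ = -(m : ℚ) / n)
    (hτ : IsPartition τ) {α γ : Fin N → ℕ} (hα : Antitone α)
    (hw : ∀ r : Fin N, (univ.filter (fun q => α q = (r : ℕ))).card = τ r)
    (h : ∀ p, n * γ p = m * rowShift τ (α p)) : IsLambda κ₀ τ γ := by
  intro s i h1 h2
  have e1 : univ.filter (fun j : Fin N => j < s) = univ.filter (fun j : Fin N => (j : ℕ) < s) := rfl
  have e2 : univ.filter (fun j : Fin N => j ≤ s) =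
      univ.filter (fun j : Fin N => (j : ℕ) < s + 1) :=
    filter_congr fun j _ => by rw [Nat.lt_succ_iff]; rfl
  rw [e1] at h1 ⊢
  rw [e2] at h2
  obtain ⟨h3, h4⟩ := nodesAbove_le_of_antitone hτ hα hw i.rev
  rw [Fin.rev_rev] at h3 h4
  have hs : (s : ℕ) = α i.rev := row_unique h1 h2 h3 h4
  have h5 := h i.rev
  rw [← hs, rowShift] at h5
  have h6 : (n : ℚ) * γ i.rev = m * ∑ j ∈ univ.filter (fun j : Fin N => (j : ℕ) < s),
      ((τ j : ℚ) + 1) := by exact_mod_cast h5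
  have hn0 : (n : ℚ) ≠ 0 := by exact_mod_cast hn.ne'
  rw [hκ]
  field_simp
  linarith

/-- Every nonempty row `r` gives `n ∣ m * rowShift τ r`. Subtracting this for two consecutive rows
leaves `n ∣ m * (τ i + 1)`, and `m` is coprime to `n`. -/
theorem dvd_of_rowShift {m n : ℕ} (hmn : m.gcd n = 1) (hτ : IsPartition τ) {α γ : Fin N → ℕ}
    (hw : ∀ r : Fin N, (univ.filter (fun q => α q = (r : ℕ))).card = τ r)
    (h : ∀ p, n * γ p = m * rowShift τ (α p)) (i : Fin N) (hi : (i : ℕ) + 1 < len τ) :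
    n ∣ τ i + 1 := by
  obtain ⟨j, hj, hij⟩ := (Finset.lt_sup_iff).1 hi
  have hj := (mem_filter.1 hj).2
  have hi1 : (i : ℕ) + 1 < N := by have := j.2; omega
  have hpos : ∀ r : Fin N, r ≤ j → n ∣ m * rowShift τ r := by
    intro r hr
    have h1 : 0 < (univ.filter (fun q => α q = (r : ℕ))).card := by
      rw [hw r]
      exact hj.trans_le (hτ.1 hr)
    obtain ⟨p, hp⟩ := card_pos.1 h1
    have hp := (mem_filter.1 hp).2
    rw [← hp, ← h p]
    exact Dvd.intro _ rfl
  have h1 := hpos i (Fin.le_def.2 (by omega))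
  have h2 := hpos ⟨i + 1, hi1⟩ (Fin.le_def.2 (by simp; omega))
  simp only at h2
  rw [rowShift, sum_filter_lt_succ, mul_add] at h2
  rw [rowShift] at h1
  exact Nat.Coprime.dvd_of_dvd_mul_left (Nat.Coprime.symm hmn) ((Nat.dvd_add_right h1).1 h2)

end RowWords

/-! ### From lattice words to standard tableaux -/

section WordTableau

variable {N : ℕ} {τ : Fin N → ℕ}

theorem card_gt_lt {α : Fin N → ℕ} {p p' : Fin N} (h : p < p') (e : α p' = α p) :
    (univ.filter (fun q => p' < q ∧ α q = α p')).card <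
      (univ.filter (fun q => p < q ∧ α q = α p)).card := by
  refine card_lt_card ⟨fun q hq => ?_, fun hsub => ?_⟩
  · simp only [mem_filter, mem_univ, true_and] at hq ⊢
    exact ⟨h.trans hq.1, hq.2.trans e⟩
  · have : p' ∈ univ.filter (fun q => p' < q ∧ α q = α p') := hsub (by simp [h, e])
    simp at this

/-- A lattice word of weight `τ` lists the rows of a standard tableau, with matching contents. -/
theorem exists_standard_of_isLatticeWord (hτ : IsPartition τ) {α : Fin N → ℕ}
    (hα : IsLatticeWord τ α) :
    ∃ T : Tableau τ, IsStandard T ∧ ∀ k, content T k = expContent α k.rev := by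
  have hlt : ∀ p, (univ.filter (fun q => p < q ∧ α q = α p)).card <
      τ ⟨α p, lt_of_card_eq hτ hα.2 p⟩ := by
    intro p
    rw [← hα.2 ⟨α p, lt_of_card_eq hτ hα.2 p⟩]
    refine card_lt_card ⟨fun q hq => ?_, fun hsub => ?_⟩
    · simp only [mem_filter, mem_univ, true_and] at hq ⊢
      exact hq.2
    · have : p ∈ univ.filter (fun q => p < q ∧ α q = α p) := hsub (by simp)
      simp at this
  -- Words are read from the end: entry `k` goes to the row named at position `k.rev`, in the column
  -- that counts the later occurrences of the same letter.
  let F : Fin N → (Σ r : Fin N, Fin (τ r)) := fun k =>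
    ⟨⟨α k.rev, lt_of_card_eq hτ hα.2 _⟩,
      ⟨(univ.filter (fun q => k.rev < q ∧ α q = α k.rev)).card, hlt _⟩⟩
  have hF : ∀ a b, ((F a).1 : ℕ) = (F b).1 → ((F a).2 : ℕ) < (F b).2 → a < b := by
    intro a b h1 h2
    have h1 : α a.rev = α b.rev := h1
    by_contra hab
    rcases (not_lt.1 hab).eq_or_lt with rfl | hab
    · exact lt_irrefl _ h2
    · exact lt_asymm h2 (card_gt_lt (Fin.rev_lt_rev.2 hab) h1.symm)
  have hinj : Function.Injective F := by
    intro a b hab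
    by_contra hne
    have h1 : α a.rev = α b.rev := congrArg (fun x => (x.1 : ℕ)) hab
    have h2 : ((F a).2 : ℕ) = (F b).2 := congrArg (fun x => (x.2 : ℕ)) hab
    rcases lt_or_gt_of_ne hne with h | h
    · exact absurd h2.symm (card_gt_lt (Fin.rev_lt_rev.2 h) h1).ne'
    · exact absurd h2 (card_gt_lt (Fin.rev_lt_rev.2 h) h1.symm).ne'
  have hbij : Function.Bijective F := by
    refine (Fintype.bijective_iff_injective_and_card F).2 ⟨hinj, ?_⟩
    rw [Fintype.card_sigma]
    simpa using hτ.2.symm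
  have hanti : ∀ p, Antitone fun r => (univ.filter (fun q => p ≤ q ∧ α q = r)).card := fun p =>
    antitone_nat_of_succ_le (hα.1 p)
  refine ⟨Equiv.ofBijective F hbij, ⟨fun a b h1 h2 => hF a b h1 h2, fun a b h1 h2 => ?_⟩,
    fun k => rfl⟩
  have h1 : (univ.filter (fun q => a.rev < q ∧ α q = α a.rev)).card =
    (univ.filter (fun q => b.rev < q ∧ α q = α b.rev)).card := h1
  have h2 : α a.rev < α b.rev := h2
  -- Otherwise the final segment starting at `b.rev` contains one more letter of the row of `b` than
  -- the common column index, and at most that many of the row of `a`, against the lattice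
  -- condition.
  by_contra hab
  have hle : a.rev ≤ b.rev := Fin.rev_le_rev.2 (not_lt.1 hab)
  have hlt' : a.rev < b.rev := lt_of_le_of_ne hle fun e => by rw [e] at h2; exact lt_irrefl _ h2
  have h3 := hanti b.rev h2.le
  simp only at h3
  have h4 : (univ.filter (fun q => b.rev ≤ q ∧ α q = α b.rev)).card =
      (univ.filter (fun q => b.rev < q ∧ α q = α b.rev)).card + 1 := by
    rw [← card_insert_of_notMem (a := b.rev) (by simp)]
    congr 1
    ext q
    simp only [mem_filter, mem_univ, true_and, mem_insert]
    constructor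
    · rintro ⟨h5, h6⟩
      rcases h5.eq_or_lt with e | e
      · exact Or.inl e.symm
      · exact Or.inr ⟨e, h6⟩
    · rintro (rfl | ⟨h5, h6⟩)
      · exact ⟨le_rfl, rfl⟩
      · exact ⟨h5.le, h6⟩
  have h5 : (univ.filter (fun q => b.rev ≤ q ∧ α q = α a.rev)).card ≤
      (univ.filter (fun q => a.rev < q ∧ α q = α a.rev)).card :=
    card_le_card fun q hq => by
      simp only [mem_filter, mem_univ, true_and] at hq ⊢
      exact ⟨hlt'.trans_le hq.1, hq.2⟩
  omega

end WordTableau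

/-! ### Singular copies of the Specht module and their leading exponent -/

section Core

variable {K : Type*} [Field K] {N : ℕ} {τ : Fin N → ℕ}

/-- Linear maps from the Specht module to polynomials that commute with permutations. -/
def IsEquivariant (ψ : (spechtModule K τ).toSubmodule →ₗ[K] MvPolynomial (Fin N) K) : Prop :=
  ∀ w u, ψ ((spechtModule K τ).toRepresentation w u) = permRep K N w (ψ u)

/-- All values are annihilated by the Dunkl operators. -/
def IsSingularMap (κ : K) (ψ : (spechtModule K τ).toSubmodule →ₗ[K] MvPolynomial (Fin N) K) :
    Prop :=
  ∀ u, ψ u ∈ singularSubrep κ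

theorem IsEquivariant.sub_smul {ψ φ : (spechtModule K τ).toSubmodule →ₗ[K] MvPolynomial (Fin N) K}
    (hψ : IsEquivariant ψ) (hφ : IsEquivariant φ) (c d : K) : IsEquivariant (c • ψ - d • φ) := by
  intro w u
  simp only [LinearMap.sub_apply, LinearMap.smul_apply, hψ w u, hφ w u, map_sub, map_smul]

theorem IsSingularMap.sub_smul {κ : K}
    {ψ φ : (spechtModule K τ).toSubmodule →ₗ[K] MvPolynomial (Fin N) K}
    (hψ : IsSingularMap κ ψ) (hφ : IsSingularMap κ φ) (c d : K) :
    IsSingularMap κ (c • ψ - d • φ) := fun u =>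
  (singularSubrep κ).toSubmodule.sub_mem ((singularSubrep κ).toSubmodule.smul_mem c (hψ u))
    ((singularSubrep κ).toSubmodule.smul_mem d (hφ u))

theorem IsEquivariant.murphyMap_apply {ψ : (spechtModule K τ).toSubmodule →ₗ[K] MvPolynomial (Fin N) K}
    (hψ : IsEquivariant ψ) (p : Fin N) (u : (spechtModule K τ).toSubmodule) :
    murphyMap K p (ψ u) = ψ ⟨murphyMap K p u.1, murphyMap_mem p u.2⟩ := by
  have h : (⟨murphyMap K p u.1, murphyMap_mem p u.2⟩ : (spechtModule K τ).toSubmodule) =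
      ∑ q ∈ univ.filter (fun q => p < q),
        (spechtModule K τ).toRepresentation (Equiv.swap p q) u := by
    apply Subtype.ext
    change murphyMap K p u.1 = _
    rw [AddSubmonoidClass.coe_finsetSum, murphyMap, LinearMap.sum_apply]
    rfl
  rw [h, map_sum, murphyMap, LinearMap.sum_apply]
  exact sum_congr rfl fun q _ => (hψ _ u).symm

theorem IsEquivariant.isContentVector
    {ψ : (spechtModule K τ).toSubmodule →ₗ[K] MvPolynomial (Fin N) K} (hψ : IsEquivariant ψ)
    {α : Fin N → ℕ} {u : (spechtModule K τ).toSubmodule} (hu : IsContentVector α u.1) :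
    IsContentVector α (ψ u) := by
  intro p
  rw [hψ.murphyMap_apply p u, ← map_smul]
  congr 1
  exact Subtype.ext (hu p)

theorem opU_of_isContentVector {κ : K} {f : MvPolynomial (Fin N) K} (hf : f ∈ singularSubrep κ)
    {α : Fin N → ℕ} (h : IsContentVector α f) (p : Fin N) :
    opU κ p f = (1 + κ * (expContent α p : K)) • f := by
  rw [opU_of_dunkl_eq_zero (hf p), ← murphyMap_apply, h p, add_smul, one_smul, mul_smul]

/-- `α` lists the rows of the row reading tableau and `lam` is the exponent attached to it. -/
def IsLeadingPair (m n : ℕ) (τ : Fin N → ℕ) (lam α : Fin N →₀ ℕ) : Prop :=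
  Antitone lam ∧ Antitone α ∧ IsLatticeWord τ α ∧ ∀ p, n * lam p = m * rowShift τ (α p)

theorem IsLeadingPair.unique {m n : ℕ} (hn : 0 < n) (hτ : IsPartition τ)
    {lam α lam' α' : Fin N →₀ ℕ} (h : IsLeadingPair m n τ lam α)
    (h' : IsLeadingPair m n τ lam' α') : lam = lam' ∧ α = α' := by
  have e : α = α' :=
    DFunLike.coe_injective (antitone_word_unique hτ h.2.1 h'.2.1 h.2.2.1.2 h'.2.2.1.2)
  refine ⟨?_, e⟩
  ext p
  apply Nat.eq_of_mul_eq_mul_left hn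
  rw [h.2.2.2 p, h'.2.2.2 p, e]

variable [CharZero K]

theorem IsLeadingPair.xi_eq {m n : ℕ} (hn : 0 < n) {κ₀ : ℚ} (hκ : κ₀ = -(m : ℚ) / n)
    (hτ : IsPartition τ) {lam α : Fin N →₀ ℕ} (h : IsLeadingPair m n τ lam α) (p : Fin N) :
    xi (κ₀ : K) lam p = 1 + (κ₀ : K) * (expContent α p : K) := by
  rw [xi_eq_iff hn hκ h.1, sub_expContent_of_antitone hτ h.2.1 h.2.2.1.2]
  exact_mod_cast h.2.2.2 p

/-- The exponents of a singular copy of the Specht module have a greatest element, determined by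
the shape. -/
theorem exists_leadingPair {m n : ℕ} (hm : 0 < m) (hn : 0 < n) {κ₀ : ℚ} (hκ : κ₀ = -(m : ℚ) / n)
    (hτ : IsPartition τ) {ψ : (spechtModule K τ).toSubmodule →ₗ[K] MvPolynomial (Fin N) K}
    (hψ : IsEquivariant ψ) (hs : IsSingularMap (κ₀ : K) ψ) (h0 : ψ ≠ 0) :
    ∃ lam α, IsLeadingPair m n τ lam α ∧
      (∃ v, IsContentVector α v.1 ∧ (ψ v).coeff lam ≠ 0) ∧
      ∀ u β, (ψ u).coeff β ≠ 0 → β = lam ∨ Above lam β := by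
  let X : Set (Fin N →₀ ℕ) := {β | ∃ u, (ψ u).coeff β ≠ 0}
  -- `X` collects the exponents of the whole image, so it is stable under permutations; any maximal
  -- element turns out to be the exponent prescribed by `τ`.
  have hX : ∀ γ, IsMaximalIn X γ → ∃ α, IsLeadingPair m n τ γ α ∧
      ∃ v, IsContentVector α v.1 ∧ (ψ v).coeff γ ≠ 0 := by
    rintro γ ⟨⟨u, hu⟩, hmax⟩
    have hanti : Antitone γ := by
      obtain ⟨ha, w, hw⟩ := sorted_spec γ
      have hw' : sorted γ = permExp w γ := by
        rw [hw]; funext p; simp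
      by_cases he : sorted γ = γ
      · rwa [he] at ha
      · refine absurd (above_sorted he) ?_
        rw [hw']
        refine hmax _ ⟨(spechtModule K τ).toRepresentation w⁻¹ u, ?_⟩
        rw [← coeff_permRep, ← hψ, ← Module.End.mul_apply, ← map_mul, mul_inv_cancel, map_one]
        exact hu
    -- Content vectors span the Specht module, so the coefficient at `γ` cannot vanish on all of
    -- them.
    obtain ⟨v, α, hα, hv, hv0⟩ : ∃ (v : (spechtModule K τ).toSubmodule) (α : Fin N →₀ ℕ),
        IsLatticeWord τ α ∧ IsContentVector α v.1 ∧ (ψ v).coeff γ ≠ 0 := by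
      by_contra hno
      push Not at hno
      let Z := Submodule.map (spechtModule K τ).toSubmodule.subtype
        (LinearMap.ker (lcoeff K γ ∘ₗ ψ))
      have hle : Submodule.span K {v | v ∈ spechtModule K τ ∧
          ∃ α : Fin N →₀ ℕ, IsLatticeWord τ α ∧ IsContentVector α v} ≤ Z := by
        refine Submodule.span_le.2 ?_
        rintro v ⟨h1, α, h2, h3⟩
        exact ⟨⟨v, h1⟩, hno ⟨v, h1⟩ α h2 h3, rfl⟩
      obtain ⟨u', h1, h2⟩ := hle (mem_span_contentVectors hτ u.2)
      rw [show u' = u from Subtype.ext h2] at h1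
      exact hu h1
    have heig : ∀ p : Fin N, (n : ℤ) * γ p = m * (((N : ℤ) - 1 - p) - expContent α p) := by
      intro p
      rw [← xi_eq_iff (K := K) hn hκ hanti]
      -- The coefficient of `x^γ` in `U_p (ψ v)` in two ways: by triangularity, and through the
      -- Murphy eigenvalue of a singular vector.
      have h1 := coeff_opU_of_isMaximalIn (κ₀ : K) p (f := ψ v) (γ := γ)
        fun β hβ => hmax β ⟨v, mem_support_iff.1 hβ⟩
      rw [opU_of_isContentVector (hs v) (hψ.isContentVector hv), coeff_smul, smul_eq_mul] at h1
      exact (mul_right_cancel₀ hv0 h1).symm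
    have hα' := antitone_of_eigenvalues hm hα.1 hanti heig
    refine ⟨α, ⟨hanti, hα', hα, fun p => ?_⟩, v, hv, hv0⟩
    have h1 := heig p
    rw [sub_expContent_of_antitone hτ hα' hα.2] at h1
    exact_mod_cast h1
  obtain ⟨u, hu⟩ : ∃ u, ψ u ≠ 0 := by
    by_contra h
    push Not at h
    exact h0 (LinearMap.ext h)
  obtain ⟨β, hβ⟩ := ne_zero_iff.1 hu
  obtain ⟨lam, hlam, -⟩ := exists_isMaximalIn_above (S := X) (β := β) ⟨u, hβ⟩
  obtain ⟨α, hα, hv⟩ := hX lam hlam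
  refine ⟨lam, α, hα, hv, fun u β hβ => ?_⟩
  obtain ⟨γ, hγ, h1⟩ := exists_isMaximalIn_above (S := X) (β := β) ⟨u, hβ⟩
  obtain ⟨α', hα', -⟩ := hX γ hγ
  rw [(hα'.unique hn hτ hα).1] at h1
  exact h1.imp Eq.symm id

/-- A singular equivariant map is determined by the leading coefficient of one vector. -/
theorem IsLeadingPair.map_eq_zero {m n : ℕ} (hm : 0 < m) (hn : 0 < n) {κ₀ : ℚ}
    (hκ : κ₀ = -(m : ℚ) / n) (hτ : IsPartition τ) {lam α : Fin N →₀ ℕ}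
    (h : IsLeadingPair m n τ lam α)
    {ψ : (spechtModule K τ).toSubmodule →ₗ[K] MvPolynomial (Fin N) K}
    (hψ : IsEquivariant ψ) (hs : IsSingularMap (κ₀ : K) ψ)
    {v : (spechtModule K τ).toSubmodule} (hv : IsContentVector α v.1) (hv0 : v ≠ 0)
    (hc : (ψ v).coeff lam = 0) : ψ = 0 := by
  by_contra h0
  -- A nonzero map has a leading pair of its own. It must be the given one, and its eigenvector is a
  -- multiple of `v`.
  obtain ⟨lam', α', h', ⟨v', hv', hc'⟩, -⟩ := exists_leadingPair hm hn hκ hτ hψ hs h0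
  obtain ⟨rfl, rfl⟩ := h.unique hn hτ h'
  have e := hv'.eq_smul hτ v'.2 v.2 hv fun e => hv0 (Subtype.ext e)
  have e' : v' = (v'.1.coeff α / v.1.coeff α) • v := Subtype.ext e
  rw [e', map_smul, coeff_smul, hc, smul_zero] at hc'
  exact hc' rfl

end Core

/-! ### Passing between irreducible submodules and equivariant maps -/

section Irreducible

variable {K : Type*} [Field K] {N : ℕ} {τ : Fin N → ℕ}

/-- An irreducible module of type `τ` is the image of an equivariant embedding of the Specht
module. -/
theorem IsIrreducibleOfType.exists_map {M : Subrepresentation (permRep K N)}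
    (hM : IsIrreducibleOfType τ M) :
    ∃ ψ : (spechtModule K τ).toSubmodule →ₗ[K] MvPolynomial (Fin N) K,
      IsEquivariant ψ ∧ Function.Injective ψ ∧ (∀ u, ψ u ∈ M) ∧ (∀ f ∈ M, ∃ u, ψ u = f) ∧
      ψ ≠ 0 := by
  obtain ⟨hirr, -, ⟨φ⟩⟩ := hM
  refine ⟨M.toSubmodule.subtype ∘ₗ φ.toLinearEquiv.symm.toLinearMap, ?_, ?_, ?_, ?_, ?_⟩
  · intro w u
    obtain ⟨x, rfl⟩ := φ.toLinearEquiv.surjective u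
    have h : (spechtModule K τ).toRepresentation w (φ.toLinearEquiv x) =
        φ.toLinearEquiv (M.toRepresentation w x) :=
      (LinearMap.congr_fun (φ.isIntertwining' w) x).symm
    simp only [LinearMap.comp_apply, LinearEquiv.coe_coe]
    rw [h, LinearEquiv.symm_apply_apply, LinearEquiv.symm_apply_apply]
    rfl
  · exact (Subtype.val_injective).comp φ.toLinearEquiv.symm.injective
  · exact fun u => (φ.toLinearEquiv.symm u).2
  · exact fun f hf => ⟨φ.toLinearEquiv ⟨f, hf⟩,
      congrArg Subtype.val (φ.toLinearEquiv.symm_apply_apply ⟨f, hf⟩)⟩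
  · intro h0
    have : Nontrivial (Subrepresentation M.toRepresentation) := hirr.toNontrivial
    obtain ⟨P, Q, hPQ⟩ := exists_pair_ne (Subrepresentation M.toRepresentation)
    apply hPQ
    have hzero : ∀ x : M.toSubmodule, x = 0 := fun x => by
      have := LinearMap.congr_fun h0 (φ.toLinearEquiv x)
      rw [LinearMap.comp_apply, LinearEquiv.coe_coe, LinearEquiv.symm_apply_apply] at this
      exact Subtype.ext this
    apply Subrepresentation.toSubmodule_injective
    ext x
    rw [hzero x]
    simp

/-- The singular elements of `M`, with zero, form a subrepresentation, and it is not zero. -/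
theorem IsIrreducibleOfType.le_singularSubrep {M : Subrepresentation (permRep K N)}
    (hM : IsIrreducibleOfType τ M) {κ : K} {f : MvPolynomial (Fin N) K} (hf : IsSingular κ f)
    (hfM : f ∈ M) : ∀ g ∈ M, g ∈ singularSubrep κ := by
  have := hM.1
  let P : Subrepresentation M.toRepresentation :=
    { toSubmodule := (singularSubrep κ).toSubmodule.comap M.toSubmodule.subtype
      apply_mem_toSubmodule := fun w v hv => (singularSubrep κ).apply_mem_toSubmodule w hv }
  rcases eq_bot_or_eq_top P with h | h
  · have h1 : (⟨f, hfM⟩ : M.toSubmodule) ∈ P := hf.2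
    rw [h] at h1
    exact absurd (congrArg Subtype.val (show (⟨f, hfM⟩ : M.toSubmodule) = 0 from h1)) hf.1
  · intro g hg
    have h1 : (⟨g, hg⟩ : M.toSubmodule) ∈ P := by rw [h]; trivial
    exact h1

end Irreducible

/-! ### Descent of coefficients to the rationals -/

section Rationality

variable {K : Type*} [Field K] {N : ℕ} {τ : Fin N → ℕ}

/-- A Specht polynomial as an element of the Specht module. -/
noncomputable def spechtElem (K : Type*) [Field K] (T : Tableau τ) :
    (spechtModule K τ).toSubmodule :=
  ⟨spechtPoly K T, Submodule.subset_span ⟨T, rfl⟩⟩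

theorem spechtElem_permRep (w : Equiv.Perm (Fin N)) (T : Tableau τ) :
    (spechtModule K τ).toRepresentation w (spechtElem K T) =
      spechtElem K (w.symm.trans T : Tableau τ) :=
  Subtype.ext (rename_spechtPoly K T w)

theorem linearCombination_spechtElem_surjective :
    Function.Surjective (Finsupp.linearCombination K (spechtElem K (τ := τ))) := by
  intro u
  obtain ⟨c, hc⟩ := Finsupp.mem_span_range_iff_exists_finsupp.1
    (show u.1 ∈ Submodule.span K (Set.range fun T : Tableau τ => spechtPoly K T) from u.2)
  refine ⟨c, Subtype.ext ?_⟩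
  rw [← hc, Finsupp.linearCombination_apply, Finsupp.sum, Finsupp.sum,
    AddSubmonoidClass.coe_finsetSum]
  rfl

variable [CharZero K]

/-- Apply a rational functional to all coefficients. -/
noncomputable def mapCoeff (π : K →ₗ[ℚ] ℚ) :
    MvPolynomial (Fin N) K →+ MvPolynomial (Fin N) K where
  toFun f := ∑ β ∈ f.support, monomial β ((π (f.coeff β) : ℚ) : K)
  map_zero' := by simp
  map_add' f g := by
    have h : ∀ f : MvPolynomial (Fin N) K, ∀ γ,
        (∑ β ∈ f.support, monomial β ((π (f.coeff β) : ℚ) : K)).coeff γ =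
          ((π (f.coeff γ) : ℚ) : K) := by
      intro f γ
      rw [coeff_sum]
      simp only [coeff_monomial]
      rw [sum_ite_eq' f.support]
      split_ifs with h
      · rfl
      · rw [notMem_support_iff.1 h, map_zero, Rat.cast_zero]
    ext γ
    rw [coeff_add, h, h, h, coeff_add, map_add, Rat.cast_add]

@[simp] theorem coeff_mapCoeff (π : K →ₗ[ℚ] ℚ) (f : MvPolynomial (Fin N) K) (γ : Fin N →₀ ℕ) :
    (mapCoeff π f).coeff γ = ((π (f.coeff γ) : ℚ) : K) := by
  change (∑ β ∈ f.support, monomial β ((π (f.coeff β) : ℚ) : K)).coeff γ = _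
  rw [coeff_sum]
  simp only [coeff_monomial]
  rw [sum_ite_eq' f.support]
  split_ifs with h
  · rfl
  · rw [notMem_support_iff.1 h, map_zero, Rat.cast_zero]

theorem apply_ratCast_mul (π : K →ₗ[ℚ] ℚ) (q : ℚ) (a : K) : π ((q : K) * a) = q * π a := by
  rw [← Rat.smul_def, map_smul, smul_eq_mul]

theorem mapCoeff_ratCast_smul (π : K →ₗ[ℚ] ℚ) (q : ℚ) (f : MvPolynomial (Fin N) K) :
    mapCoeff π ((q : K) • f) = (q : K) • mapCoeff π f := by
  ext γ
  rw [coeff_mapCoeff, coeff_smul, coeff_smul, coeff_mapCoeff, smul_eq_mul, smul_eq_mul,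
    apply_ratCast_mul, Rat.cast_mul]

theorem mapCoeff_smul_of_rational (π : K →ₗ[ℚ] ℚ) (a : K) {f : MvPolynomial (Fin N) K}
    (hf : ∀ β, ∃ q : ℚ, f.coeff β = (q : K)) :
    mapCoeff π (a • f) = ((π a : ℚ) : K) • f := by
  ext γ
  obtain ⟨q, hq⟩ := hf γ
  rw [coeff_mapCoeff, coeff_smul, coeff_smul, hq, smul_eq_mul, smul_eq_mul, mul_comm,
    apply_ratCast_mul, Rat.cast_mul, mul_comm]

theorem mapCoeff_permRep (π : K →ₗ[ℚ] ℚ) (w : Equiv.Perm (Fin N)) (f : MvPolynomial (Fin N) K) :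
    mapCoeff π (permRep K N w f) = permRep K N w (mapCoeff π f) := by
  ext γ
  rw [coeff_mapCoeff, coeff_permRep, coeff_permRep, coeff_mapCoeff]

theorem mapCoeff_monomial (π : K →ₗ[ℚ] ℚ) (α : Fin N →₀ ℕ) (a : K) :
    mapCoeff π (monomial α a) = monomial α ((π a : ℚ) : K) := by
  ext γ
  rw [coeff_mapCoeff, coeff_monomial, coeff_monomial]
  split_ifs <;> simp

theorem mapCoeff_X_mul (π : K →ₗ[ℚ] ℚ) (i : Fin N) (f : MvPolynomial (Fin N) K) :
    mapCoeff π (X i * f) = X i * mapCoeff π f := by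
  ext γ
  rw [coeff_mapCoeff, coeff_X_mul', coeff_X_mul']
  split_ifs
  · rw [coeff_mapCoeff]
  · rw [map_zero, Rat.cast_zero]

theorem mapCoeff_pderiv (π : K →ₗ[ℚ] ℚ) (i : Fin N) (f : MvPolynomial (Fin N) K) :
    mapCoeff π (pderiv i f) = pderiv i (mapCoeff π f) := by
  induction f using MvPolynomial.induction_on' with
  | monomial α a =>
    rw [pderiv_monomial, mapCoeff_monomial, mapCoeff_monomial, pderiv_monomial]
    congr 1
    have := apply_ratCast_mul π (α i : ℚ) a
    rw [Rat.cast_natCast] at this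
    rw [mul_comm, this, mul_comm]
    push_cast
    ring
  | add p q hp hq => rw [map_add, map_add, hp, hq, map_add, map_add]

theorem mapCoeff_divDiff (π : K →ₗ[ℚ] ℚ) {i j : Fin N} (hij : i ≠ j)
    (f : MvPolynomial (Fin N) K) :
    mapCoeff π (divDiff i j f) = divDiff i j (mapCoeff π f) := by
  refine divDiff_unique hij ?_
  rw [sub_mul, ← mapCoeff_X_mul, ← mapCoeff_X_mul, ← map_sub, ← sub_mul, divDiff_spec, map_sub,
    mapCoeff_permRep]

/-- A functional that is only `ℚ`-linear suffices, because for rational `κ` the operator has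
rational structure constants. -/
theorem mapCoeff_dunkl (π : K →ₗ[ℚ] ℚ) (κ : ℚ) (i : Fin N) (f : MvPolynomial (Fin N) K) :
    mapCoeff π (dunkl (κ : K) i f) = dunkl (κ : K) i (mapCoeff π f) := by
  rw [dunkl, dunkl, map_add, mapCoeff_pderiv, mapCoeff_ratCast_smul, map_sum]
  congr 2
  exact sum_congr rfl fun j hj => mapCoeff_divDiff π (mem_filter.1 hj).2.symm f

theorem mapCoeff_mem_singularSubrep (π : K →ₗ[ℚ] ℚ) (κ : ℚ) {f : MvPolynomial (Fin N) K}
    (hf : f ∈ singularSubrep (κ : K)) : mapCoeff π f ∈ singularSubrep (κ : K) := fun i => by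
  rw [← mapCoeff_dunkl, hf i, map_zero]

theorem spechtPoly_rational (T : Tableau τ) (β : Fin N →₀ ℕ) :
    ∃ q : ℚ, (spechtPoly K T).coeff β = (q : K) := by
  refine ⟨(spechtPoly ℚ T).coeff β, ?_⟩
  have : spechtPoly K T = MvPolynomial.map (algebraMap ℚ K) (spechtPoly ℚ T) := by
    simp [spechtPoly, map_prod]
  rw [this, coeff_map]
  rfl

theorem mapCoeff_linearCombination (π : K →ₗ[ℚ] ℚ) (c : Tableau τ →₀ K) :
    mapCoeff π (Finsupp.linearCombination K (spechtElem K (τ := τ)) c).1 =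
      (∑ T ∈ c.support, ((π (c T) : ℚ) : K) • spechtElem K T).1 := by
  rw [Finsupp.linearCombination_apply, Finsupp.sum, AddSubmonoidClass.coe_finsetSum,
    AddSubmonoidClass.coe_finsetSum, map_sum]
  exact sum_congr rfl fun T _ => mapCoeff_smul_of_rational π (c T) (spechtPoly_rational T)

theorem mapCoeff_mem_spechtModule (π : K →ₗ[ℚ] ℚ) {f : MvPolynomial (Fin N) K}
    (hf : f ∈ spechtModule K τ) : mapCoeff π f ∈ spechtModule K τ := by
  obtain ⟨c, hc⟩ := linearCombination_spechtElem_surjective (⟨f, hf⟩ : (spechtModule K τ).toSubmodule)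
  have h := mapCoeff_linearCombination π c
  rw [hc] at h
  change mapCoeff π f = _ at h
  rw [h]
  exact Subtype.property _

theorem exists_functional (K : Type*) [Field K] [CharZero K] : ∃ π : K →ₗ[ℚ] ℚ, π 1 = 1 := by
  obtain ⟨π, hπ⟩ := LinearMap.exists_leftInverse_of_injective (Algebra.linearMap ℚ K)
    (LinearMap.ker_eq_bot.2 (algebraMap ℚ K).injective)
  refine ⟨π, ?_⟩
  have := LinearMap.congr_fun hπ 1
  simpa using this

/-- Conjugating an equivariant map with a rational projection of the coefficients. -/
theorem exists_rational_map {κ₀ : ℚ} (π : K →ₗ[ℚ] ℚ)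
    {ψ : (spechtModule K τ).toSubmodule →ₗ[K] MvPolynomial (Fin N) K}
    (hψ : IsEquivariant ψ) (hs : IsSingularMap (κ₀ : K) ψ) :
    ∃ φ : (spechtModule K τ).toSubmodule →ₗ[K] MvPolynomial (Fin N) K,
      IsEquivariant φ ∧ IsSingularMap (κ₀ : K) φ ∧
      ∀ u, mapCoeff π u.1 = u.1 → φ u = mapCoeff π (ψ u) := by
  let E := Finsupp.linearCombination K (spechtElem K (τ := τ))
  let R := Finsupp.linearCombination K fun T : Tableau τ => mapCoeff π (ψ (spechtElem K T))
  have hE : Function.Surjective E := linearCombination_spechtElem_surjective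
  -- Well-definedness of the new map. Specht polynomials have rational coefficients, so any
  -- `ℚ`-functional `ρ` turns a `K`-linear relation among them into a rational one, which survives
  -- `ψ` and `π`. Since all `ρ` annihilate the resulting coefficient, it is zero.
  have hker : LinearMap.ker E ≤ LinearMap.ker R := by
    intro c hc
    rw [LinearMap.mem_ker] at hc ⊢
    ext γ
    rw [coeff_zero]
    refine (Module.forall_dual_apply_eq_zero_iff ℚ _).1 fun ρ => ?_
    have h1 := mapCoeff_linearCombination ρ c
    change mapCoeff ρ (E c).1 = _ at h1
    rw [hc] at h1
    have h2 : ∑ T ∈ c.support, ((ρ (c T) : ℚ) : K) • spechtElem K T = 0 :=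
      Subtype.ext (h1.symm.trans (map_zero _))
    have h3 := congrArg (fun u => ((mapCoeff π (ψ u)).coeff γ)) h2
    simp only [map_sum, map_smul, map_zero, coeff_zero, coeff_sum, mapCoeff_ratCast_smul,
      coeff_smul, coeff_mapCoeff, smul_eq_mul] at h3
    have h4 : ∑ T ∈ c.support, ρ (c T) * π ((ψ (spechtElem K T)).coeff γ) = 0 := by
      exact_mod_cast h3
    simp only [R, Finsupp.linearCombination_apply, Finsupp.sum, coeff_sum, coeff_smul,
      coeff_mapCoeff, smul_eq_mul, map_sum]
    rw [← h4]
    refine sum_congr rfl fun T _ => ?_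
    rw [mul_comm, apply_ratCast_mul, mul_comm]
  let φ := (LinearMap.ker E).liftQ R hker ∘ₗ (E.quotKerEquivOfSurjective hE).symm.toLinearMap
  have hφ : ∀ c, φ (E c) = R c := by
    intro c
    simp only [φ, LinearMap.comp_apply, LinearEquiv.coe_coe]
    have : (E.quotKerEquivOfSurjective hE).symm (E c) = (LinearMap.ker E).mkQ c := by
      rw [LinearEquiv.symm_apply_eq]
      rfl
    rw [this]
    rfl
  have hφT : ∀ T : Tableau τ, φ (spechtElem K T) = mapCoeff π (ψ (spechtElem K T)) := by
    intro T
    have := hφ (Finsupp.single T 1)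
    simpa [E, R] using this
  have hind : ∀ A B : (spechtModule K τ).toSubmodule →ₗ[K] MvPolynomial (Fin N) K,
      (∀ T : Tableau τ, A (spechtElem K T) = B (spechtElem K T)) → A = B := by
    intro A B h
    refine LinearMap.ext fun u => ?_
    obtain ⟨c, rfl⟩ := hE u
    simp only [E, Finsupp.linearCombination_apply, Finsupp.sum, map_sum, map_smul, h]
  refine ⟨φ, fun w u => ?_, fun u => ?_, fun u hu => ?_⟩
  · refine LinearMap.congr_fun (hind (φ ∘ₗ (spechtModule K τ).toRepresentation w)
      (permRep K N w ∘ₗ φ) fun T => ?_) u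
    change φ ((spechtModule K τ).toRepresentation w (spechtElem K T)) =
      permRep K N w (φ (spechtElem K T))
    rw [spechtElem_permRep, hφT, hφT, ← mapCoeff_permRep, ← hψ, spechtElem_permRep]
  · obtain ⟨c, rfl⟩ := hE u
    simp only [E, Finsupp.linearCombination_apply, Finsupp.sum, map_sum, map_smul, hφT]
    exact (singularSubrep (κ₀ : K)).toSubmodule.sum_mem fun T _ =>
      (singularSubrep (κ₀ : K)).toSubmodule.smul_mem _ (mapCoeff_mem_singularSubrep π κ₀ (hs _))
  · obtain ⟨c, rfl⟩ := hE u
    have h1 := mapCoeff_linearCombination π c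
    change mapCoeff π (E c).1 = _ at h1
    rw [hu] at h1
    have h2 : E c = ∑ T ∈ c.support, ((π (c T) : ℚ) : K) • spechtElem K T := Subtype.ext h1
    rw [h2]
    simp only [map_sum, map_smul, hφT, mapCoeff_ratCast_smul]

theorem mapCoeff_murphyMap (π : K →ₗ[ℚ] ℚ) (p : Fin N) (f : MvPolynomial (Fin N) K) :
    mapCoeff π (murphyMap K p f) = murphyMap K p (mapCoeff π f) := by
  rw [murphyMap, LinearMap.sum_apply, LinearMap.sum_apply, map_sum]
  exact sum_congr rfl fun q _ => mapCoeff_permRep π _ f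

/-- Contents are integers, so the projected vector has the same eigenvalues; the eigenspace is a
line and the normalization `1` is preserved. -/
theorem IsContentVector.mapCoeff_eq_self (hτ : IsPartition τ) {π : K →ₗ[ℚ] ℚ} (hπ : π 1 = 1)
    {v : MvPolynomial (Fin N) K} (hv : v ∈ spechtModule K τ) {α : Fin N →₀ ℕ}
    (hα : IsContentVector α v) (h1 : v.coeff α = 1) : mapCoeff π v = v := by
  have h2 : IsContentVector α (mapCoeff π v) := by
    intro p
    rw [← mapCoeff_murphyMap, hα p]
    have h := mapCoeff_ratCast_smul π (expContent α p : ℚ) v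
    rwa [Rat.cast_intCast] at h
  have h0 : v ≠ 0 := by
    rintro rfl
    simp at h1
  have h3 := h2.eq_smul hτ (mapCoeff_mem_spechtModule π hv) hv hα h0
  rwa [coeff_mapCoeff, h1, hπ, Rat.cast_one, div_one, one_smul] at h3

end Rationality

end SingularPoly

/-! ### Assembly of the three assertions -/

theorem mainTheorem2 {K : Type*} [Field K] [CharZero K] (N m n : ℕ)
    (hn : 2 ≤ n) (hnN : n ≤ N) (hmn : m.gcd n = 1)
    (κ₀ : ℚ) (hκ : κ₀ = -(m : ℚ) / n)
    (τ : Fin N → ℕ) (hτ : IsPartition τ)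
    (hex : ∃ f : MvPolynomial (Fin N) K, IsSingular (κ₀ : K) f ∧ HasIsotype τ f) :
    (∀ i : Fin N, (i : ℕ) + 1 < len τ → n ∣ τ i + 1) ∧
    ∃ lam : Fin N →₀ ℕ, Antitone lam ∧ IsLambda κ₀ τ lam ∧
      (∃ g : MvPolynomial (Fin N) K,
        IsLeadingSingular (κ₀ : K) τ lam g ∧
        (∀ β, ∃ q : ℚ, g.coeff β = (q : K)) ∧
        ∀ h : MvPolynomial (Fin N) K, IsLeadingSingular (κ₀ : K) τ lam h → h = g) ∧
      (∀ M : Subrepresentation (permRep K N), IsIrreducibleOfType τ M →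
        (∀ f ∈ M, ∀ i, dunkl (κ₀ : K) i f = 0) →
        ∀ α, IsMaximalIn (maximalExponents τ M) α ↔ α = lam) := by
  have hn0 : 0 < n := by omega
  -- `gcd(0, n) = n ≥ 2`, so coprimality excludes `m = 0`.
  have hm0 : 0 < m := by
    rcases Nat.eq_zero_or_pos m with rfl | h
    · rw [Nat.gcd_zero_left] at hmn
      omega
    · exact h
  have hκ0 : (κ₀ : K) ≠ 0 := by
    rw [Rat.cast_ne_zero, hκ]
    have h1 : (m : ℚ) ≠ 0 := by exact_mod_cast hm0.ne'
    have h2 : (n : ℚ) ≠ 0 := by exact_mod_cast hn0.ne'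
    exact div_ne_zero (neg_ne_zero.2 h1) h2
  obtain ⟨f, hf, M, hM, hfM⟩ := hex
  have hMs := hM.le_singularSubrep hf hfM
  obtain ⟨ψ, hψ, -, hψM, -, hψ0⟩ := hM.exists_map
  have hψs : IsSingularMap (κ₀ : K) ψ := fun u => hMs _ (hψM u)
  obtain ⟨lam, α, hpair, ⟨v, hv, hvlam⟩, hbelow⟩ := exists_leadingPair hm0 hn0 hκ hτ hψ hψs hψ0
  have hv0 : v ≠ 0 := by
    rintro rfl
    simp at hvlam
  have hα0 : v.1.coeff α ≠ 0 := hv.coeff_ne_zero hτ v.2 fun e => hv0 (Subtype.ext e)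
  refine ⟨fun i hi => dvd_of_rowShift hmn hτ hpair.2.2.1.2 hpair.2.2.2 i hi, lam, hpair.1,
    isLambda_of_rowShift hn0 hκ hτ hpair.2.1 hpair.2.2.1.2 hpair.2.2.2, ?_, ?_⟩
  · set g : MvPolynomial (Fin N) K := ((ψ v).coeff lam)⁻¹ • ψ v with hg
    have hgM : g ∈ M := M.toSubmodule.smul_mem _ (hψM v)
    have hglam : g.coeff lam = 1 := by
      rw [hg, coeff_smul, smul_eq_mul, inv_mul_cancel₀ hvlam]
    have hg0 : g ≠ 0 := by
      intro e
      rw [e, coeff_zero] at hglam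
      exact zero_ne_one hglam
    -- Rigidity: the difference of the two normalized maps is singular and equivariant, and has no
    -- `x^λ` term on `v`.
    have huniq : ∀ φ : (spechtModule K τ).toSubmodule →ₗ[K] MvPolynomial (Fin N) K,
        IsEquivariant φ → IsSingularMap (κ₀ : K) φ → ∀ c : K, (c • φ v).coeff lam = 1 →
        c • φ v = g := by
      intro φ hφ hφs c hc
      have h0 := hpair.map_eq_zero hm0 hn0 hκ hτ (hφ.sub_smul hψ c ((ψ v).coeff lam)⁻¹)
        (hφs.sub_smul hψs c _) hv hv0 (by
          rw [LinearMap.sub_apply, LinearMap.smul_apply, LinearMap.smul_apply, coeff_sub, hc,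
            ← hg, hglam, sub_self])
      have h1 := LinearMap.congr_fun h0 v
      exact sub_eq_zero.1 h1
    refine ⟨g, ⟨⟨hg0, hMs g hgM⟩, ⟨M, hM, hgM⟩, ⟨hglam, fun β hβ hne => ?_⟩, fun p => ?_⟩, ?_, ?_⟩
    · rw [mem_support_iff, hg, coeff_smul] at hβ
      exact (hbelow v β (right_ne_zero_of_smul hβ)).resolve_left hne
    · rw [hpair.xi_eq hn0 hκ hτ, hg, opU_smul,
        opU_of_isContentVector (hψs v) (hψ.isContentVector hv), smul_comm]
    · obtain ⟨π, hπ⟩ := exists_functional K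
      have hgv : (v.1.coeff α * ((ψ v).coeff lam)⁻¹) • ψ ((v.1.coeff α)⁻¹ • v) = g := by
        -- `v` is rescaled to have leading coefficient `1`, which makes it rational, and the scalar
        -- is moved into the map so that the value is still `g`.
        rw [map_smul, smul_smul, hg, mul_right_comm, mul_inv_cancel₀ hα0, one_mul]
      have hπv : mapCoeff π ((v.1.coeff α)⁻¹ • v).1 = ((v.1.coeff α)⁻¹ • v).1 := by
        refine IsContentVector.mapCoeff_eq_self hτ hπ ((v.1.coeff α)⁻¹ • v).2 (α := α) ?_ ?_
        · intro p
          change murphyMap K p ((v.1.coeff α)⁻¹ • v.1) = _ • ((v.1.coeff α)⁻¹ • v.1)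
          rw [map_smul, hv p, smul_comm]
        · change ((v.1.coeff α)⁻¹ • v.1).coeff α = 1
          rw [coeff_smul, smul_eq_mul, inv_mul_cancel₀ hα0]
      -- The zero second coefficient makes this a plain scalar multiple of `ψ`.
      obtain ⟨φ, hφ, hφs, hφu⟩ := exists_rational_map π
        (hψ.sub_smul hψ (v.1.coeff α * ((ψ v).coeff lam)⁻¹) 0) (hψs.sub_smul hψs _ 0)
      have h1 := hφu _ hπv
      rw [LinearMap.sub_apply, LinearMap.smul_apply, LinearMap.smul_apply, zero_smul, sub_zero,
        hgv, map_smul] at h1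
      have h2 := huniq φ hφ hφs (v.1.coeff α)⁻¹ (by
        rw [h1, coeff_mapCoeff, hglam, hπ, Rat.cast_one])
      rw [h1] at h2
      intro β
      exact ⟨π (g.coeff β), by rw [← coeff_mapCoeff, h2]⟩
    · rintro h ⟨hh, ⟨M', hM', hhM'⟩, ⟨hhlam, -⟩, hU⟩
      have hMs' := hM'.le_singularSubrep hh hhM'
      obtain ⟨ψ', hψ', hinj, hψM', hsurj, -⟩ := hM'.exists_map
      obtain ⟨u, rfl⟩ := hsurj h hhM'
      -- As `κ₀ ≠ 0`, the `U`-eigenvalues of `h` determine its Murphy eigenvalues. These pull back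
      -- along the injective `ψ'`, so the preimage is a multiple of `v` although `h` may lie in
      -- another copy.
      have hu : IsContentVector α u.1 := by
        intro p
        have h1 := hU p
        rw [opU_of_dunkl_eq_zero (hh.2 p), ← murphyMap_apply, hpair.xi_eq hn0 hκ hτ, add_smul,
          one_smul, mul_smul, add_right_inj] at h1
        have h2 := smul_right_injective _ hκ0 h1
        rw [hψ'.murphyMap_apply p u, ← map_smul] at h2
        exact congrArg Subtype.val (hinj h2)
      have e : u = (u.1.coeff α / v.1.coeff α) • v :=
        Subtype.ext (hu.eq_smul hτ u.2 v.2 hv fun e => hv0 (Subtype.ext e))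
      rw [e, map_smul] at hhlam ⊢
      exact huniq ψ' hψ' (fun u => hMs' _ (hψM' u)) _ hhlam
  · intro M' hM' hMs' β
    obtain ⟨ψ', hψ', -, hψM', hsurj, hψ0'⟩ := hM'.exists_map
    obtain ⟨lam', α', hpair', ⟨v', hv', hvlam'⟩, hbelow'⟩ :=
      exists_leadingPair hm0 hn0 hκ hτ hψ' (fun u => hMs' _ (hψM' u)) hψ0'
    obtain ⟨rfl, rfl⟩ := hpair.unique hn0 hτ hpair'
    have hsub : ∀ γ ∈ maximalExponents τ M', γ = lam ∨ Above lam γ := by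
      rintro γ ⟨T, -, f, ⟨hfM', -, -⟩, hγ⟩
      obtain ⟨u, rfl⟩ := hsurj f hfM'
      exact hbelow' u γ (mem_support_iff.1 hγ.1)
    have hmem : lam ∈ maximalExponents τ M' := by
      -- The row reading word comes from a standard tableau, so `λ` is attained by a genuine Murphy
      -- vector.
      obtain ⟨T, hT, hcont⟩ := exists_standard_of_isLatticeWord hτ hpair.2.2.1
      refine ⟨T, hT, ψ' v', ⟨hψM' v', ?_, fun i => ?_⟩, mem_support_iff.2 hvlam', ?_⟩
      · intro e
        rw [e] at hvlam'
        exact hvlam' (coeff_zero _)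
      · rw [hcont i, ← hψ'.isContentVector hv' i.rev, murphyMap_apply, Fin.rev_rev]
      · intro γ hγ hab
        rcases hbelow' v' γ (mem_support_iff.1 hγ) with rfl | h
        · exact not_above_self _ hab
        · exact not_above_self _ (hab.trans h)
    constructor
    · rintro ⟨hβ, hmax⟩
      exact (hsub β hβ).resolve_right (hmax lam hmem)
    · rintro rfl
      refine ⟨hmem, fun γ hγ hab => ?_⟩
      rcases hsub γ hγ with rfl | h
      · exact not_above_self _ hab
      · exact not_above_self _ (hab.trans h)
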